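/- **Timed communicating automata.** Clocks take values in $\mathbb Q_{\ge 0}$ and are integral or fractional; in constraints an integral clock with value $v$ evaluates to $\lfloor v\rfloor$, a fractional one to $\{v\}\in\mathbb I:=\mathbb Q\cap[0,1)$. A *simple system of timed communicating automata* $\mathcal S$ consists of a finite directed graph of processes $P$ and channels $C\subseteq P\times P$ without self-channels $pp$, a finite set of messages, finite sets $X^{p}$ (local clocks of $p$) and $X^{pq}$ (clocks of the channel $pq$), and for every process $p$ finitely many locations with an initial one $\ell_I^p$ and a final one $\ell_F^p$, and finitely many transitions labelled with one of: $\mathsf{nop}$; $\mathsf{elapse}$; $\mathsf{test}(\varphi)$ with $\varphi$ of one of the forms $x\sim k$, $x\equiv_m k$ ($x\in X^p$ integral), $y\sim 0$, $y\sim y'$ ($y,y'\in X^p$ fractional); $\mathsf{reset}(x)$ with $x\in X^p$; $\mathsf{send}(m,pq,\,x=0)$ with $x\in X^{pq}$; $\mathsf{receive}(m,qp,\psi)$ with $\psi$ of one of the forms $x\sim k$, $x\equiv_m k$ ($x\in X^{qp}$ integral), $x\sim y$ ($x\in X^{qp}$, $y\in X^p$ fractional). Here $\sim\,\in\{<,\le,=,\ge,>\}$,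 and a send and a receive operation for the same message and channel speak about the same channel clock. Let $M\ge1$ be such that $k\le M$ in all inequalities $x\sim k$ and $m=M$ in all modular constraints. **Rendezvous semantics $[\![\mathcal S]\!]^{\mathsf{rv}}$.** Every process $p$ has in addition a reference clock $x_0^p$, which is never reset and occurs in no constraint. Configurations are pairs $(\ell,\mu)$ of a location $\ell^p$ for each process and a valuation $\mu$ of all local and reference clocks with $\mu(x_0^p)\le\mu(x_0^q)$ for all $pq\in C$. Initially $\ell=\ell_I$ and $\mu=0$; a configuration is final if $\ell=\ell_F$, all local clocks other than the reference clocks are $0$, and $\mu(x_0^p)=\mu(x_0^q)$ for all $pq\in C$. A step is either a $\mathsf{nop}$, $\mathsf{test}$ or $\mathsf{reset}$ transition of one process; or an $\mathsf{elapse}$ transition of one process $p$, adding the same $\delta\in\mathbb Q_{\ge0}$ to $x_0^p$ and all clocks in $X^p$; or the simultaneous execution of a matching send of $p$ and receive of $q$ for some $pq\in C$, possible if there is a valuation $\mu^{pq}$ of $X^{pq}$ (natural numbers for integral, values in $[0,1)$ for fractional clocks) such that $(\mu,\mu^{pq})$ satisfies the send constraint and $(\mu,\mu^{pq}+\delta)$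 the receive constraint, where $\delta=\mu(x_0^q)-\mu(x_0^p)$. **Register automata with counters.** Such an automaton has finitely many locations, $\mathbb I$-valued registers, $\mathbb N$-valued counters, and rules labelled with finite sequences of the operations: $\mathsf{nop}$, increment, decrement (of a positive counter), tests $n\sim k$ and $n\equiv_m k$ of a counter $n$, $\mathsf{guess}(a)$ (arbitrary new value for register $a$), and tests of a quantifier-free formula on registers over equality and the strict cyclic order $K(a,b,c)\equiv a<b<c\vee b<c<a\vee c<a<b$. The initial and the final configuration consist of the initial, resp. final, location with all counters and registers $0$. **The automaton $\mathcal R$.** Call $a,b\in\mathbb N$ *$M$-unary equivalent* if ($a=b$ or $a,b>M$) and $a\equiv b\pmod M$. A unary class $\lambda$ assigns such an equivalence class to every local (non-reference) clock; $[\mu]$ is the class of $\lfloor\mu\rfloor$, $\lambda\models\varphi$ means $\mu\models\varphi$ for some $\mu$ with $[\mu]=\lambda$, and $\lambda[Y\mapsto Y+1]$ has the obvious meaning. Put $a\ominus b=\{a-b\}$, $K_0(a,b,c)\equiv K(a,b,c)\vee a=b\vee b=c$, $K_1(a,b,c)\equiv K(a,b,c)\vee a\ne b=c$, $K_2(a,b,c)\equiv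 K(a,b,c)\vee a=b\neq c$. $\mathcal R$ has a register $\hat x$ for every local clock $x$ (time stamp of its last reset), registers $\hat x_0^p,\hat x_1^p$ for every process (current time modulo $1$, and an auxiliary copy), and a counter $n^{pq}$ for every channel $pq$ (integral desynchronisation $\lfloor x_0^q-x_0^p\rfloor$). Its locations are the pairs $(\ell,\lambda)$ and temporary locations; the initial and final one are $(\ell_I,[0])$ and $(\ell_F,[0])$. Below, a move from $(\ell,\lambda)$ is understood to change the location of the acting processes as in $\mathcal S$ and, unless stated otherwise, to keep $\lambda$. The rules are: 1. $\mathsf{nop}$ of $\mathcal S$ is simulated by $\mathsf{nop}$. 2. $\mathsf{elapse}$ of $p$ is simulated through temporary locations by, successively: (a) $\mathsf{nop}$; (b) any number of times: increment all $n^{qp}$, decrement all $n^{pq}$, and replace $\lambda$ by $\lambda[X^p\mapsto X^p+1]$; (c) $\mathsf{guess}(\hat x_1^p);\mathsf{test}(\hat x_1^p=\hat x_0^p)$; (d) $\mathsf{guess}(\hat x_0^p)$; (e) for a guessed subset $Y$ of $S^+\cup S^-$, where $S^+=\{\hat x: x\in X^p\}\cup\{\hat x_0^q: qp\in C\}$ and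 $S^-=\{\hat x_0^q: pq\in C\}$, test that each $a\in S^+$ is in $Y$ iff $K_1(\hat x_1^p,a,\hat x_0^p)$, and each $a\in S^-$ is in $Y$ iff $K_2(\hat x_1^p,a,\hat x_0^p)$; then increment the $n^{qp}$ with $\hat x_0^q\in Y$, decrement the $n^{pq}$ with $\hat x_0^q\in Y$, and increase $\lambda$ by $1$ on the $x\in X^p$ with $\hat x\in Y$; (f) $\mathsf{nop}$. 3. A test $x\sim k$ or $x\equiv_m k$ is simulated by $\mathsf{nop}$ if $\lambda$ satisfies it; a test $y\sim y'$, resp. $y\sim0$, of $p$ by testing $\hat x_0^p\ominus\hat y\sim\hat x_0^p\ominus\hat y'$, resp. $\hat x_0^p\ominus\hat y\sim 0$, which are expressed by means of $K_0$ (as $c\ominus b\le c\ominus a$ iff $K_0(a,b,c)$). 4. A reset of $x\in X^p$ is simulated by $\mathsf{guess}(\hat x);\mathsf{test}(\hat x=\hat x_0^p)$, and $\lambda(x)$ becomes $[0]$. 5. A matching send-receive pair on $pq$ is simulated by the test $n^{pq}\sim k$, $n^{pq}\equiv_m k$, or $\hat x_0^q\ominus\hat x_0^p\sim\hat x_0^q\ominus\hat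 y$ (expressed by $K_0$), if the receive constraint is $x\sim k$, $x\equiv_m k$, or $x\sim y$, respectively. 6. From $(\ell_F,[0])$ to itself: test that $\hat x=\hat x_0^p$ for all $p$ and $x\in X^p$ and that $\hat x_0^p=\hat x_0^q$ for all $pq\in C$; guess new values for all registers; repeat the test. **Lemma.** $[\![\mathcal S]\!]^{\mathsf{rv}}$ and $[\![\mathcal R]\!]$ are equivalent: a final configuration is reachable from the initial one in $[\![\mathcal S]\!]^{\mathsf{rv}}$ if and only if the final configuration is reachable from the initial one in $[\![\mathcal R]\!]$. -/

import Mathlib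

open scoped NNRat

universe u

/- ## Labelled transition systems -/

/-- A labelled transition system. Acceptance is given by a set of final configurations. -/
structure LTS where
  Config : Type u
  Action : Type u
  start : Config
  final : Set Config
  step : Config → Action → Config → Prop

/-- `A.Path c w d`: the sequence of actions `w` leads from `c` to `d`. -/
inductive LTS.Path (A : LTS.{u}) : A.Config → List A.Action → A.Config → Prop
  | nil (c : A.Config) : LTS.Path A c [] c
  | cons {c d e : A.Config} {a : A.Action} {w : List A.Action} :
      A.step c a d → LTS.Path A d w e → LTS.Path A c (a :: w) e

/-- Positive answer to the non-emptiness problem. -/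
def LTS.NonEmptiness (A : LTS.{u}) : Prop :=
  ∃ (w : List A.Action) (c : A.Config), c ∈ A.final ∧ A.Path A.start w c

open Classical in
/-- The family `f[i ↦ b]`. -/
noncomputable def setAt {ι : Type*} {β : ι → Type*} (f : ∀ i, β i) (i : ι) (b : β i) :
    ∀ i, β i :=
  Function.update f i b

/- ## Clocks and clock constraints -/

inductive ClockKind
  | classical
  | integral
  | fractional

/-- Comparison symbols. -/
inductive Cmp
  | lt
  | le
  | eq
  | ge
  | gt

def Cmp.Holds {α : Type*} [LinearOrder α] : Cmp → α → α → Prop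
  | .lt, a, b => a < b
  | .le, a, b => a ≤ b
  | .eq, a, b => a = b
  | .ge, a, b => b ≤ a
  | .gt, a, b => b < a

/-- The value to which a clock with underlying value `v` evaluates inside constraints. -/
def ClockKind.value : ClockKind → ℚ≥0 → ℚ
  | .classical, v => (v : ℚ)
  | .integral, v => (⌊(v : ℚ)⌋ : ℚ)
  | .fractional, v => Int.fract (v : ℚ)

/-- The domain of a clock: `ℚ≥0` for classical, `ℕ` for integral, `[0, 1)` for fractional ones. -/
def ClockKind.Domain : ClockKind → ℚ≥0 → Prop
  | .classical, _ => True
  | .integral, v => ∃ n : ℕ, v = n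
  | .fractional, v => v < 1

/-- Atomic clock constraints: inequality and modular constraints speak about classical or integral
clocks (two clocks of the same kind if diagonal), order constraints about fractional ones. -/
inductive Atom {X : Type u} (kind : X → ClockKind) : Type u
  /-- `x ∼ k` -/
  | ineq (x : X) (hx : kind x ≠ .fractional) (c : Cmp) (k : ℤ)
  /-- `x - y ∼ k` -/
  | ineqDiff (x y : X) (hx : kind x ≠ .fractional) (hy : kind y = kind x) (c : Cmp) (k : ℤ)
  /-- `x ≡ k` modulo `m` -/
  | modular (x : X) (hx : kind x ≠ .fractional) (m : ℕ) (hm : 0 < m) (k : ℤ)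
  /-- `x - y ≡ k` modulo `m` -/
  | modularDiff (x y : X) (hx : kind x ≠ .fractional) (hy : kind y = kind x)
      (m : ℕ) (hm : 0 < m) (k : ℤ)
  /-- `x ∼ 0` -/
  | zero (x : X) (hx : kind x = .fractional) (c : Cmp)
  /-- `x ∼ y` -/
  | order (x y : X) (hx : kind x = .fractional) (hy : kind y = .fractional) (c : Cmp)

/-- Clock constraints: boolean combinations of atomic ones. -/
inductive Constraint {X : Type u} (kind : X → ClockKind) : Type u
  | tt
  | atom (a : Atom kind)
  | neg (φ : Constraint kind)
  | conj (φ ψ : Constraint kind)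
  | disj (φ ψ : Constraint kind)

namespace Atom

variable {X : Type u} {kind : X → ClockKind}

def Sat (μ : X → ℚ≥0) : Atom kind → Prop
  | ineq x _ c k => c.Holds ((kind x).value (μ x)) (k : ℚ)
  | ineqDiff x y _ _ c k => c.Holds ((kind x).value (μ x) - (kind y).value (μ y)) (k : ℚ)
  | modular x _ m _ k => ⌊(kind x).value (μ x)⌋ ≡ k [ZMOD m]
  | modularDiff x y _ _ m _ k =>
      ⌊(kind x).value (μ x) - (kind y).value (μ y)⌋ ≡ k [ZMOD m]
  | zero x _ c => c.Holds ((kind x).value (μ x)) 0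
  | order x y _ _ c => c.Holds ((kind x).value (μ x)) ((kind y).value (μ y))

/-- The constants of inequalities are at most `M` and all moduli are equal to `M`. -/
def BoundedBy (M : ℕ) : Atom kind → Prop
  | ineq _ _ _ k => k ≤ M
  | ineqDiff _ _ _ _ _ k => k ≤ M
  | modular _ _ m _ _ => m = M
  | modularDiff _ _ _ _ m _ _ => m = M
  | zero _ _ _ => True
  | order _ _ _ _ _ => True

/-- The atom is neither a diagonal inequality nor a diagonal modular constraint. -/
def NoDiff : Atom kind → Prop
  | ineqDiff _ _ _ _ _ _ => False
  | modularDiff _ _ _ _ _ _ _ => False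
  | _ => True

end Atom

namespace Constraint

variable {X : Type u} {kind : X → ClockKind}

def Sat (μ : X → ℚ≥0) : Constraint kind → Prop
  | tt => True
  | atom a => a.Sat μ
  | neg φ => ¬ φ.Sat μ
  | conj φ ψ => φ.Sat μ ∧ ψ.Sat μ
  | disj φ ψ => φ.Sat μ ∨ ψ.Sat μ

def BoundedBy (M : ℕ) : Constraint kind → Prop
  | tt => True
  | atom a => a.BoundedBy M
  | neg φ => φ.BoundedBy M
  | conj φ ψ => φ.BoundedBy M ∧ ψ.BoundedBy M
  | disj φ ψ => φ.BoundedBy M ∧ ψ.BoundedBy M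

open Classical in
/-- The atomic constraint `x = 0`, for a clock `x` of any kind. -/
noncomputable def isZero (kind : X → ClockKind) (x : X) : Constraint kind :=
  if h : kind x = .fractional then atom (.zero x h .eq) else atom (.ineq x h .eq 0)

end Constraint

/- ## Systems of timed communicating automata -/

/-- Operations of the automaton `p`. Channel constraints speak about the local clocks of `p`
(left summand) and the clocks of the channel (right summand). -/
inductive TcaOp {P : Type u} (chan : P → P → Prop) (Msg : Type u) {Clk : P → Type u}
    {ChClk : P → P → Type u} (kind : ∀ p, Clk p → ClockKind)
    (chKind : ∀ p q, ChClk p q → ClockKind) (p : P) : Type u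
  | nop
  | elapse
  | test (φ : Constraint (kind p))
  | reset (x : Clk p)
  | send (m : Msg) (q : P) (h : chan p q) (ψ : Constraint (Sum.elim (kind p) (chKind p q)))
  | receive (m : Msg) (q : P) (h : chan q p) (ψ : Constraint (Sum.elim (kind p) (chKind q p)))

/-- A system of timed communicating automata. The reference clock of `p`, which is never reset and
does not occur in constraints, is not listed among the clocks `Clk p`. -/
structure TCA where
  Proc : Type u
  chan : Proc → Proc → Prop
  Msg : Type u
  Clk : Proc → Type u
  ChClk : Proc → Proc → Type u
  kind : ∀ p, Clk p → ClockKind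
  chKind : ∀ p q, ChClk p q → ClockKind
  Loc : Proc → Type u
  start : ∀ p, Loc p
  final : ∀ p, Loc p
  rules : ∀ p, Set (Loc p × TcaOp chan Msg kind chKind p × Loc p)
  finite_proc : Finite Proc
  finite_msg : Finite Msg
  finite_clk : ∀ p, Finite (Clk p)
  finite_chClk : ∀ p q, Finite (ChClk p q)
  finite_loc : ∀ p, Finite (Loc p)
  finite_rules : ∀ p, (rules p).Finite

namespace TCA

attribute [instance] TCA.finite_proc TCA.finite_msg TCA.finite_clk TCA.finite_chClk TCA.finite_loc

variable (S : TCA.{u})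

/-- The operations of the automaton `p` of `S`. -/
abbrev Op (p : S.Proc) : Type u := TcaOp S.chan S.Msg S.kind S.chKind p

/-- All local clocks except for the reference clocks. -/
abbrev LocalClk : Type u := Σ p : S.Proc, S.Clk p

/-- All channels. -/
abbrev Chan : Type u := {c : S.Proc × S.Proc // S.chan c.1 c.2}

/-- `ψ` is a receive constraint of a simple system which speaks about the channel clock `x`:
`x ∼ k` or `x ≡ k` for integral `x`, and `x ∼ y` with a local clock `y` for fractional `x`. -/
inductive SimpleReceive {p q : S.Proc} (x : S.ChClk p q) :
    Constraint (Sum.elim (S.kind q) (S.chKind p q)) → Prop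
  | ineq (hx) (c : Cmp) (k : ℤ) : SimpleReceive x (.atom (.ineq (.inr x) hx c k))
  | modular (hx) (m : ℕ) (hm : 0 < m) (k : ℤ) :
      SimpleReceive x (.atom (.modular (.inr x) hx m hm k))
  | order (y : S.Clk q) (hx hy) (c : Cmp) :
      SimpleReceive x (.atom (.order (.inr x) (.inl y) hx hy c))

/-- Simple systems. -/
structure IsSimple : Prop where
  clk : ∀ p x, S.kind p x ≠ .classical
  chClk : ∀ p q x, S.chKind p q x ≠ .classical
  send : ∀ p q (h : S.chan p q) m ψ l r, (l, TcaOp.send m q h ψ, r) ∈ S.rules p →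
    ∃ x : S.ChClk p q, ψ = Constraint.isZero _ (.inr x)
  receive : ∀ p q (h : S.chan p q) m ψ l r, (l, TcaOp.receive m p h ψ, r) ∈ S.rules q →
    ∃ x : S.ChClk p q, S.SimpleReceive x ψ
  /-- Matching send and receive operations speak about the same channel clock. -/
  sameClk : ∀ p q (h : S.chan p q) m (x : S.ChClk p q) ψ l r l' r',
    (l, TcaOp.send m q h (Constraint.isZero _ (.inr x)), r) ∈ S.rules p →
    (l', TcaOp.receive m p h ψ, r') ∈ S.rules q → S.SimpleReceive x ψ

/-- Local tests are atomic and there are neither diagonal inequality nor diagonal modular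
constraints among them. -/
def NoLocalDiff : Prop :=
  ∀ p l r φ, (l, TcaOp.test φ, r) ∈ S.rules p → ∃ a, φ = .atom a ∧ a.NoDiff

/-- `M` bounds the constants of all inequality constraints and is the only modulus. -/
structure BoundedBy (M : ℕ) : Prop where
  test : ∀ p l r φ, (l, TcaOp.test φ, r) ∈ S.rules p → φ.BoundedBy M
  send : ∀ p q (h : S.chan p q) m ψ l r, (l, TcaOp.send m q h ψ, r) ∈ S.rules p → ψ.BoundedBy M
  receive : ∀ p q (h : S.chan p q) m ψ l r, (l, TcaOp.receive m p h ψ, r) ∈ S.rules q →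
    ψ.BoundedBy M

/- ## Rendezvous semantics -/

/-- Control locations, values of the local clocks, and values of the reference clocks
(all channels are empty). -/
structure RvConfig where
  loc : ∀ p, S.Loc p
  val : S.LocalClk → ℚ≥0
  now : S.Proc → ℚ≥0

/-- No receiver is behind a sender. -/
def RvConfig.Ordered {S : TCA.{u}} (c : S.RvConfig) : Prop :=
  ∀ p q, S.chan p q → c.now p ≤ c.now q

/-- Actions of the rendezvous semantics. -/
inductive RvAction
  | op (p : S.Proc) (o : S.Op p)
  | delay (δ : ℚ≥0)
  | pair (p q : S.Proc) (o : S.Op p) (o' : S.Op q)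

open Classical in
/-- Transitions of the rendezvous semantics. Time elapses locally in one automaton. A send and a
matching receive operation are executed simultaneously: the channel clocks, whose initial values
`κ` are chosen in the respective domains so as to satisfy the send constraint, are advanced by the
desynchronisation `δ` before the receive constraint is checked. -/
inductive RvStep : S.RvConfig → S.RvAction → S.RvConfig → Prop
  | nop (c : S.RvConfig) (p : S.Proc) (r : S.Loc p) :
      (c.loc p, .nop, r) ∈ S.rules p →
      RvStep c (.op p .nop) ⟨setAt c.loc p r, c.val, c.now⟩
  | test (c : S.RvConfig) (p : S.Proc) (r : S.Loc p) (φ : Constraint (S.kind p)) :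
      (c.loc p, .test φ, r) ∈ S.rules p → φ.Sat (fun x => c.val ⟨p, x⟩) →
      RvStep c (.op p (.test φ)) ⟨setAt c.loc p r, c.val, c.now⟩
  | reset (c : S.RvConfig) (p : S.Proc) (r : S.Loc p) (x : S.Clk p) :
      (c.loc p, .reset x, r) ∈ S.rules p →
      RvStep c (.op p (.reset x)) ⟨setAt c.loc p r, setAt c.val ⟨p, x⟩ 0, c.now⟩
  | elapse (c : S.RvConfig) (p : S.Proc) (r : S.Loc p) (δ : ℚ≥0) :
      (c.loc p, .elapse, r) ∈ S.rules p →
      RvStep c (.delay δ) ⟨setAt c.loc p r,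
        fun x => if x.1 = p then c.val x + δ else c.val x, setAt c.now p (c.now p + δ)⟩
  | pair (c : S.RvConfig) (p q : S.Proc) (h : S.chan p q) (m : S.Msg) (ψ ψ')
      (r : S.Loc p) (r' : S.Loc q) (κ : S.ChClk p q → ℚ≥0) (δ : ℚ≥0) :
      (c.loc p, .send m q h ψ, r) ∈ S.rules p →
      (c.loc q, .receive m p h ψ', r') ∈ S.rules q →
      (∀ x, (S.chKind p q x).Domain (κ x)) →
      c.now q = c.now p + δ →
      ψ.Sat (Sum.elim (fun x => c.val ⟨p, x⟩) κ) →
      ψ'.Sat (Sum.elim (fun x => c.val ⟨q, x⟩) (fun x => κ x + δ)) →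
      RvStep c (.pair p q (.send m q h ψ) (.receive m p h ψ'))
        ⟨setAt (setAt c.loc p r) q r', c.val, c.now⟩

/-- The rendezvous semantics. In a final configuration all clocks are zero, except for the
reference clocks, which agree along every channel. -/
def rendezvous : LTS where
  Config := {c : S.RvConfig // c.Ordered}
  Action := S.RvAction
  start := ⟨⟨S.start, fun _ => 0, fun _ => 0⟩, fun _ _ _ => le_rfl⟩
  final := {c | c.1.loc = S.final ∧ (∀ x, c.1.val x = 0) ∧
    ∀ p q, S.chan p q → c.1.now p = c.1.now q}
  step c a d := S.RvStep c.1 a d.1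

end TCA

/- ## Register automata with counters -/

/-- The rational unit interval `[0, 1)`. -/
abbrev UnitIco : Type := Set.Ico (0 : ℚ) 1

/-- The strict cyclic order. -/
def CycOrd (a b c : UnitIco) : Prop :=
  (a < b ∧ b < c) ∨ (b < c ∧ c < a) ∨ (c < a ∧ a < b)

/-- Register constraints: quantifier-free formulas over the cyclic order. -/
inductive RegFormula (R : Type u) : Type u
  | tt
  | eq (a b : R)
  | cyc (a b c : R)
  | neg (φ : RegFormula R)
  | conj (φ ψ : RegFormula R)
  | disj (φ ψ : RegFormula R)

namespace RegFormula

variable {R : Type u}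

def Sat (r : R → UnitIco) : RegFormula R → Prop
  | tt => True
  | eq a b => r a = r b
  | cyc a b c => CycOrd (r a) (r b) (r c)
  | neg φ => ¬ φ.Sat r
  | conj φ ψ => φ.Sat r ∧ ψ.Sat r
  | disj φ ψ => φ.Sat r ∨ ψ.Sat r

/-- Conjunction of a finite family of formulas. -/
noncomputable def all {ι : Type*} [Finite ι] (f : ι → RegFormula R) : RegFormula R :=
  ((Set.finite_univ (α := ι)).toFinset.toList.map f).foldr conj tt

/-- `K₀(a, b, c)`, that is, `c ⊖ b ≤ c ⊖ a`. -/
def K₀ (a b c : R) : RegFormula R := disj (cyc a b c) (disj (eq a b) (eq b c))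

/-- `K₁(a, b, c)`: moving clockwise from `a` to `c` one reaches `b` after a positive distance. -/
def K₁ (a b c : R) : RegFormula R := disj (cyc a b c) (conj (eq b c) (neg (eq a b)))

/-- `K₂(a, b, c)`: moving clockwise from `a` to `c` one meets `b` strictly before `c`. -/
def K₂ (a b c : R) : RegFormula R := disj (cyc a b c) (conj (eq a b) (neg (eq b c)))

/-- The formula expressing `(o ⊖ a) ∼ (o ⊖ b)`. -/
def cmp (o a b : R) : Cmp → RegFormula R
  | .le => K₀ b a o
  | .ge => K₀ a b o
  | .eq => conj (K₀ b a o) (K₀ a b o)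
  | .lt => neg (K₀ a b o)
  | .gt => neg (K₀ b a o)

end RegFormula

/-- Operations on the counters `N` and the registers `R`. -/
inductive RacOp (R N : Type u) : Type u
  | nop
  | inc (n : N)
  | dec (n : N)
  | testIneq (n : N) (c : Cmp) (k : ℤ)
  | testMod (n : N) (m : ℕ) (hm : 0 < m) (k : ℤ)
  | guess (a : R)
  | test (φ : RegFormula R)

namespace RacOp

variable {R N : Type u}

/-- The effect of an operation on counter and register valuations. -/
inductive Step : RacOp R N → (N → ℕ) × (R → UnitIco) → (N → ℕ) × (R → UnitIco) → Prop
  | nop (n r) : Step .nop (n, r) (n, r)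
  | inc (n r) (i : N) : Step (.inc i) (n, r) (setAt n i (n i + 1), r)
  | dec (n r) (i : N) : 0 < n i → Step (.dec i) (n, r) (setAt n i (n i - 1), r)
  | testIneq (n r) (i : N) (c : Cmp) (k : ℤ) : c.Holds (n i : ℤ) k →
      Step (.testIneq i c k) (n, r) (n, r)
  | testMod (n r) (i : N) (m : ℕ) (hm : 0 < m) (k : ℤ) : (n i : ℤ) ≡ k [ZMOD m] →
      Step (.testMod i m hm k) (n, r) (n, r)
  | guess (n r) (a : R) (t : UnitIco) : Step (.guess a) (n, r) (n, setAt r a t)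
  | test (n r) (φ : RegFormula R) : φ.Sat r → Step (.test φ) (n, r) (n, r)

/-- The effect of a sequence of operations. -/
def SeqStep : List (RacOp R N) → (N → ℕ) × (R → UnitIco) → (N → ℕ) × (R → UnitIco) → Prop
  | [], d, e => d = e
  | o :: w, d, e => ∃ f, Step o d f ∧ SeqStep w f e

/-- Increment every counter in `A`. -/
noncomputable def incAll [Finite N] (A : Set N) : List (RacOp R N) :=
  (Set.toFinite A).toFinset.toList.map .inc

/-- Decrement every counter in `A`. -/
noncomputable def decAll [Finite N] (A : Set N) : List (RacOp R N) :=
  (Set.toFinite A).toFinset.toList.map .dec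

/-- Guess new values for all registers. -/
noncomputable def guessAll [Finite R] : List (RacOp R N) :=
  (Set.finite_univ (α := R)).toFinset.toList.map .guess

end RacOp

/-- A register automaton with counters; rules are labelled with sequences of operations. -/
structure RAC where
  Loc : Type u
  start : Loc
  final : Loc
  Reg : Type u
  Ctr : Type u
  rules : Set (Loc × List (RacOp Reg Ctr) × Loc)
  finite_loc : Finite Loc
  finite_reg : Finite Reg
  finite_ctr : Finite Ctr
  finite_rules : rules.Finite

/-- The zero of the unit interval. -/
def UnitIco.zero : UnitIco := ⟨0, le_rfl, zero_lt_one⟩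

/-- The semantics of a register automaton with counters. -/
def RAC.sem (A : RAC.{u}) : LTS where
  Config := A.Loc × (A.Ctr → ℕ) × (A.Reg → UnitIco)
  Action := List (RacOp A.Reg A.Ctr)
  start := (A.start, fun _ => 0, fun _ => UnitIco.zero)
  final := {(A.final, fun _ => 0, fun _ => UnitIco.zero)}
  step c w d := (c.1, w, d.1) ∈ A.rules ∧ RacOp.SeqStep w c.2 d.2

/- ## Unary classes -/

/-- Unary equivalence of natural numbers: equal up to the threshold `M`, and congruent
modulo `M`. -/
def UnaryEquiv (M a b : ℕ) : Prop :=
  (a ≤ M → b ≤ M → a = b) ∧ (M < a ↔ M < b) ∧ a ≡ b [MOD M]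

def unarySetoid (M : ℕ) : Setoid ℕ where
  r := UnaryEquiv M
  iseqv :=
    { refl := fun _ => ⟨fun _ _ => rfl, Iff.rfl, rfl⟩
      symm := fun h => ⟨fun ha hb => (h.1 hb ha).symm, h.2.1.symm, h.2.2.symm⟩
      trans := fun {a b c} h h' => ⟨fun ha hc => by
          have hb : b ≤ M := by
            by_contra hb
            exact absurd (h.2.1.2 (not_le.1 hb)) (not_lt.2 ha)
          exact (h.1 ha hb).trans (h'.1 hb hc), h.2.1.trans h'.2.1, h.2.2.trans h'.2.2⟩ }

/-- Unary equivalence classes of a single clock. -/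
def UnaryClass (M : ℕ) : Type := Quotient (unarySetoid M)

namespace UnaryClass

variable {M : ℕ}

/-- The class of a clock value, determined by its integral part. -/
def of (M : ℕ) (v : ℚ≥0) : UnaryClass M := Quotient.mk (unarySetoid M) ⌊v⌋₊

theorem succ_aux (a b : ℕ) (h : UnaryEquiv M a b) : UnaryEquiv M (a + 1) (b + 1) := by
  refine ⟨fun ha hb => ?_, ?_, h.2.2.add_right 1⟩
  · rw [h.1 (by omega) (by omega)]
  · rcases h with ⟨h₁, h₂, -⟩
    rcases Nat.lt_or_ge M a with ha | ha
    · have := h₂.1 ha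
      omega
    · have hb : b ≤ M := by
        by_contra hb
        exact absurd (h₂.2 (not_le.1 hb)) (not_lt.2 ha)
      rw [h₁ ha hb]

/-- The class of the values increased by one. -/
def succ : UnaryClass M → UnaryClass M :=
  Quotient.map (sa := unarySetoid M) (sb := unarySetoid M) (· + 1) succ_aux

instance [NeZero M] : Finite (UnaryClass M) := by
  let f : UnaryClass M → Fin (M + 2) × Fin M := fun s =>
    Quotient.liftOn s
      (fun a => (⟨min a (M + 1), by omega⟩, ⟨a % M, Nat.mod_lt _ (NeZero.pos M)⟩))
      (fun a b h => by
        obtain ⟨h₁, h₂, h₃⟩ := h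
        refine Prod.ext (Fin.ext ?_) (Fin.ext h₃)
        show min a (M + 1) = min b (M + 1)
        omega)
  refine Finite.of_injective f ?_
  rintro ⟨a⟩ ⟨b⟩ h
  have h1 : min a (M + 1) = min b (M + 1) := congrArg (fun z => (z.1 : ℕ)) h
  have h2 : a % M = b % M := congrArg (fun z => (z.2 : ℕ)) h
  refine Quotient.sound (s := unarySetoid M) ⟨fun _ _ => ?_, ?_, h2⟩ <;> omega

end UnaryClass

/- ## The translation -/

namespace TCA

variable (S : TCA.{u}) (M : ℕ)

/-- Unary classes of the local clocks. -/
abbrev Unary : Type u := S.LocalClk → UnaryClass M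

variable {S M} in
open Classical in
/-- `l.bump A` is the class `l[A ↦ A + 1]`. -/
noncomputable def Unary.bump (l : S.Unary M) (A : Set S.LocalClk) : S.Unary M :=
  fun x => if x ∈ A then (l x).succ else l x

variable {S M} in
/-- Satisfaction of a local constraint of `p` by some valuation in the class. -/
def Unary.Sat (l : S.Unary M) {p : S.Proc} (φ : Constraint (S.kind p)) : Prop :=
  ∃ μ : S.LocalClk → ℚ≥0, (fun x => UnaryClass.of M (μ x)) = l ∧ φ.Sat (fun x => μ ⟨p, x⟩)

/-- Registers: `clk x` is the time stamp of the last reset of the local clock `x`, `ref p` is the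
fractional part of the current time of `p`, and `aux p` is an auxiliary copy of `ref p`. -/
inductive TReg
  | clk (x : S.LocalClk)
  | ref (p : S.Proc)
  | aux (p : S.Proc)

/-- Control locations: `main ℓ l` stores the control locations and the unary class;
`tmp i ℓ p r l` are temporary locations of four kinds used for the simulation of a time elapse
transition of `p` from `ℓ p` to `r`. -/
inductive TLoc
  | main (ℓ : ∀ p, S.Loc p) (l : S.Unary M)
  | tmp (i : Fin 4) (ℓ : ∀ p, S.Loc p) (p : S.Proc) (r : S.Loc p) (l : S.Unary M)

/-- Operations of the translation; there is one counter for every channel. -/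
abbrev TOp : Type u := RacOp S.TReg S.Chan

instance : Finite S.TReg := by
  let f : S.TReg → S.LocalClk ⊕ S.Proc ⊕ S.Proc := fun a =>
    match a with
    | .clk x => .inl x
    | .ref p => .inr (.inl p)
    | .aux p => .inr (.inr p)
  refine Finite.of_injective f ?_
  rintro (_ | _ | _) (_ | _ | _) h <;> simp_all [f]

instance [NeZero M] : Finite (S.TLoc M) := by
  let f : S.TLoc M → ((∀ p, S.Loc p) × S.Unary M) ⊕
      (Fin 4 × (∀ p, S.Loc p) × (Σ p, S.Loc p) × S.Unary M) := fun a =>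
    match a with
    | .main ℓ l => .inl (ℓ, l)
    | .tmp i ℓ p r l => .inr (i, ℓ, ⟨p, r⟩, l)
  refine Finite.of_injective f ?_
  rintro (⟨_, _⟩ | ⟨_, _, _, _, _⟩) (⟨_, _⟩ | ⟨_, _, _, _, _⟩) h <;> simp_all [f]

/-- Clocks of `p`. -/
def clocksOf (p : S.Proc) : Set S.LocalClk := {x | x.1 = p}

/-- Channels incoming to `p`, and also their counters. -/
def incoming (p : S.Proc) : Set S.Chan := {c | c.1.2 = p}

/-- Channels outgoing from `p`, and also their counters. -/
def outgoing (p : S.Proc) : Set S.Chan := {c | c.1.1 = p}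

/-- Registers compared with the old and the new time of `p` by means of `K₁`. -/
def plusRegs (p : S.Proc) : Set S.TReg :=
  {a | (∃ x ∈ S.clocksOf p, a = .clk x) ∨ ∃ c ∈ S.incoming p, a = .ref c.1.1}

/-- Registers compared with the old and the new time of `p` by means of `K₂`. -/
def minusRegs (p : S.Proc) : Set S.TReg := {a | ∃ c ∈ S.outgoing p, a = .ref c.1.2}

open Classical in
/-- Verification that `Y` consists of the registers for which the respective formula holds. -/
noncomputable def wrapCheck (p : S.Proc) (Y : Set S.TReg) : RegFormula S.TReg :=
  .all fun a =>
    .conj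
      (if a ∈ S.plusRegs p then
        (if a ∈ Y then .K₁ (.aux p) a (.ref p) else .neg (.K₁ (.aux p) a (.ref p))) else .tt)
      (if a ∈ S.minusRegs p then
        (if a ∈ Y then .K₂ (.aux p) a (.ref p) else .neg (.K₂ (.aux p) a (.ref p))) else .tt)

/-- All clocks have fractional part zero, and so do all desynchronisations. -/
noncomputable def aligned : RegFormula S.TReg :=
  .conj (.all fun x : S.LocalClk => .eq (.clk x) (.ref x.1))
    (.all fun c : S.Chan => .eq (.ref c.1.1) (.ref c.1.2))

/-- The class of the zero valuation. -/
def zeroUnary : S.Unary M := fun _ => UnaryClass.of M 0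

/-- The rules of the translation. -/
inductive TRule : S.TLoc M → List S.TOp → S.TLoc M → Prop
  | nop (ℓ l) (p : S.Proc) (r : S.Loc p) :
      (ℓ p, .nop, r) ∈ S.rules p →
      TRule (.main ℓ l) [.nop] (.main (setAt ℓ p r) l)
  /- Time elapse: choice of the transition. -/
  | elapseStart (ℓ l) (p : S.Proc) (r : S.Loc p) :
      (ℓ p, .elapse, r) ∈ S.rules p →
      TRule (.main ℓ l) [.nop] (.tmp 0 ℓ p r l)
  /- Time elapse: one time unit, which can be repeated. -/
  | elapseUnit (ℓ l) (p : S.Proc) (r : S.Loc p) :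
      TRule (.tmp 0 ℓ p r l) (RacOp.incAll (S.incoming p) ++ RacOp.decAll (S.outgoing p))
        (.tmp 0 ℓ p r (l.bump (S.clocksOf p)))
  /- Time elapse: the old local time is saved. -/
  | elapseSave (ℓ l) (p : S.Proc) (r : S.Loc p) :
      TRule (.tmp 0 ℓ p r l) [.guess (.aux p), .test (.eq (.aux p) (.ref p))] (.tmp 1 ℓ p r l)
  /- Time elapse: the new local time is guessed. -/
  | elapseGuess (ℓ l) (p : S.Proc) (r : S.Loc p) :
      TRule (.tmp 1 ℓ p r l) [.guess (.ref p)] (.tmp 2 ℓ p r l)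
  /- Time elapse: clocks and counters affected by wrapping around are updated. -/
  | elapseWrap (ℓ l) (p : S.Proc) (r : S.Loc p) (Y : Set S.TReg) :
      Y ⊆ S.plusRegs p ∪ S.minusRegs p →
      TRule (.tmp 2 ℓ p r l)
        (.test (S.wrapCheck p Y) ::
          (RacOp.incAll {c | c ∈ S.incoming p ∧ .ref c.1.1 ∈ Y} ++
            RacOp.decAll {c | c ∈ S.outgoing p ∧ .ref c.1.2 ∈ Y}))
        (.tmp 3 ℓ p r (l.bump {x | x ∈ S.clocksOf p ∧ .clk x ∈ Y}))
  | elapseEnd (ℓ l) (p : S.Proc) (r : S.Loc p) :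
      TRule (.tmp 3 ℓ p r l) [.nop] (.main (setAt ℓ p r) l)
  | testIneq (ℓ) (l : S.Unary M) (p : S.Proc) (r : S.Loc p) (x hx c k) :
      (ℓ p, .test (.atom (.ineq x hx c k)), r) ∈ S.rules p →
      l.Sat (.atom (.ineq x hx c k)) →
      TRule (.main ℓ l) [.nop] (.main (setAt ℓ p r) l)
  | testMod (ℓ) (l : S.Unary M) (p : S.Proc) (r : S.Loc p) (x hx m hm k) :
      (ℓ p, .test (.atom (.modular x hx m hm k)), r) ∈ S.rules p →
      l.Sat (.atom (.modular x hx m hm k)) →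
      TRule (.main ℓ l) [.nop] (.main (setAt ℓ p r) l)
  | testZero (ℓ l) (p : S.Proc) (r : S.Loc p) (x hx c) :
      (ℓ p, .test (.atom (.zero x hx c)), r) ∈ S.rules p →
      TRule (.main ℓ l) [.test (.cmp (.ref p) (.clk ⟨p, x⟩) (.ref p) c)] (.main (setAt ℓ p r) l)
  | testOrder (ℓ l) (p : S.Proc) (r : S.Loc p) (x y hx hy c) :
      (ℓ p, .test (.atom (.order x y hx hy c)), r) ∈ S.rules p →
      TRule (.main ℓ l) [.test (.cmp (.ref p) (.clk ⟨p, x⟩) (.clk ⟨p, y⟩) c)]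
        (.main (setAt ℓ p r) l)
  | reset (ℓ) (l : S.Unary M) (p : S.Proc) (r : S.Loc p) (x : S.Clk p) :
      (ℓ p, .reset x, r) ∈ S.rules p →
      TRule (.main ℓ l) [.guess (.clk ⟨p, x⟩), .test (.eq (.clk ⟨p, x⟩) (.ref p))]
        (.main (setAt ℓ p r) (setAt l ⟨p, x⟩ (UnaryClass.of M 0)))
  | pairIneq (ℓ l) (p q : S.Proc) (h : S.chan p q) (r : S.Loc p) (r' : S.Loc q) (m)
      (x : S.ChClk p q) (hx c k) :
      (ℓ p, .send m q h (.isZero _ (.inr x)), r) ∈ S.rules p →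
      (ℓ q, .receive m p h (.atom (.ineq (.inr x) hx c k)), r') ∈ S.rules q →
      TRule (.main ℓ l) [.testIneq ⟨(p, q), h⟩ c k] (.main (setAt (setAt ℓ p r) q r') l)
  | pairMod (ℓ l) (p q : S.Proc) (h : S.chan p q) (r : S.Loc p) (r' : S.Loc q) (m)
      (x : S.ChClk p q) (hx d hd k) :
      (ℓ p, .send m q h (.isZero _ (.inr x)), r) ∈ S.rules p →
      (ℓ q, .receive m p h (.atom (.modular (.inr x) hx d hd k)), r') ∈ S.rules q →
      TRule (.main ℓ l) [.testMod ⟨(p, q), h⟩ d hd k] (.main (setAt (setAt ℓ p r) q r') l)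
  | pairOrder (ℓ l) (p q : S.Proc) (h : S.chan p q) (r : S.Loc p) (r' : S.Loc q) (m)
      (x : S.ChClk p q) (y : S.Clk q) (hx hy c) :
      (ℓ p, .send m q h (.isZero _ (.inr x)), r) ∈ S.rules p →
      (ℓ q, .receive m p h (.atom (.order (.inr x) (.inl y) hx hy c)), r') ∈ S.rules q →
      TRule (.main ℓ l) [.test (.cmp (.ref q) (.ref p) (.clk ⟨q, y⟩) c)]
        (.main (setAt (setAt ℓ p r) q r') l)
  /- In the final location the registers can be moved simultaneously along the circle. -/
  | rotate :
      TRule (.main S.final (S.zeroUnary M))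
        (.test S.aligned :: (RacOp.guessAll ++ [.test S.aligned]))
        (.main S.final (S.zeroUnary M))

/-- The words that can label a rule arising from the operation `o` of `p`. -/
noncomputable def opWords (p : S.Proc) : S.Op p → List S.TOp
  | .test (.atom (.zero x _ c)) => [.test (.cmp (.ref p) (.clk ⟨p, x⟩) (.ref p) c)]
  | .test (.atom (.order x y _ _ c)) => [.test (.cmp (.ref p) (.clk ⟨p, x⟩) (.clk ⟨p, y⟩) c)]
  | .reset x => [.guess (.clk ⟨p, x⟩), .test (.eq (.clk ⟨p, x⟩) (.ref p))]
  | .receive _ q h (.atom (.ineq (.inr _) _ c k)) => [.testIneq ⟨(q, p), h⟩ c k]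
  | .receive _ q h (.atom (.modular (.inr _) _ d hd k)) => [.testMod ⟨(q, p), h⟩ d hd k]
  | .receive _ q _ (.atom (.order (.inr _) (.inl y) _ _ c)) =>
      [.test (.cmp (.ref p) (.ref q) (.clk ⟨p, y⟩) c)]
  | _ => [.nop]

theorem finite_tRule [NeZero M] :
    {t : S.TLoc M × List S.TOp × S.TLoc M | S.TRule M t.1 t.2.1 t.2.2}.Finite := by
  let W : Set (List S.TOp) :=
    (⋃ p, (fun t => S.opWords p t.2.1) '' S.rules p) ∪
    (Set.range fun p : S.Proc =>
      (RacOp.incAll (S.incoming p) ++ RacOp.decAll (S.outgoing p) : List S.TOp)) ∪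
    (Set.range fun p : S.Proc =>
      ([.guess (.aux p), .test (.eq (.aux p) (.ref p))] : List S.TOp)) ∪
    (Set.range fun p : S.Proc => ([.guess (.ref p)] : List S.TOp)) ∪
    (Set.range fun z : S.Proc × Set S.TReg =>
      (.test (S.wrapCheck z.1 z.2) ::
          (RacOp.incAll {c | c ∈ S.incoming z.1 ∧ .ref c.1.1 ∈ z.2} ++
            RacOp.decAll {c | c ∈ S.outgoing z.1 ∧ .ref c.1.2 ∈ z.2}) : List S.TOp)) ∪
    {[.nop], .test S.aligned :: (RacOp.guessAll ++ [.test S.aligned])}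
  have hW : W.Finite := by
    refine Set.Finite.union (.union (.union (.union (.union ?_ ?_) ?_) ?_) ?_) ?_
    · exact Set.finite_iUnion fun p => (S.finite_rules p).image _
    · exact Set.finite_range _
    · exact Set.finite_range _
    · exact Set.finite_range _
    · exact Set.finite_range _
    · exact Set.toFinite _
  have key : ∀ (p : S.Proc) (t) (w : List S.TOp), t ∈ S.rules p → S.opWords p t.2.1 = w → w ∈ W :=
    fun p t w ht hw => .inl <| .inl <| .inl <| .inl <| .inl <| Set.mem_iUnion.2 ⟨p, t, ht, hw⟩
  refine Set.Finite.subset ((Set.toFinite Set.univ).prod (hW.prod (Set.toFinite Set.univ))) ?_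
  rintro ⟨a, w, b⟩ h
  refine ⟨trivial, ?_, trivial⟩
  change S.TRule M a w b at h
  change w ∈ W
  cases h with
  | nop | elapseStart | elapseEnd | testIneq | testMod => exact .inr (.inl rfl)
  | elapseUnit ℓ l p => exact .inl <| .inl <| .inl <| .inl <| .inr ⟨p, rfl⟩
  | elapseSave ℓ l p => exact .inl <| .inl <| .inl <| .inr ⟨p, rfl⟩
  | elapseGuess ℓ l p => exact .inl <| .inl <| .inr ⟨p, rfl⟩
  | elapseWrap ℓ l p r Y => exact .inl <| .inr ⟨(p, Y), rfl⟩
  | testZero ℓ l p r x hx c h => exact key p _ _ h rfl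
  | testOrder ℓ l p r x y hx hy c h => exact key p _ _ h rfl
  | reset ℓ l p r x h => exact key p _ _ h rfl
  | pairIneq ℓ l p q h r r' m x hx c k _ h' => exact key q _ _ h' rfl
  | pairMod ℓ l p q h r r' m x hx d hd k _ h' => exact key q _ _ h' rfl
  | pairOrder ℓ l p q h r r' m x y hx hy c _ h' => exact key q _ _ h' rfl
  | rotate => exact .inr (.inr rfl)

/-- The register automaton with counters simulating the rendezvous semantics of `S`. -/
def toRAC [NeZero M] : RAC where
  Loc := S.TLoc M
  start := .main S.start (S.zeroUnary M)
  final := .main S.final (S.zeroUnary M)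
  Reg := S.TReg
  Ctr := S.Chan
  rules := {t | S.TRule M t.1 t.2.1 t.2.2}
  finite_loc := inferInstance
  finite_reg := inferInstance
  finite_ctr := inferInstance
  finite_rules := S.finite_tRule M

end TCA

/-! Two simulations are run along one invariant, `TCA.Describes`. Every local clock value and every
desynchronisation is a natural number plus a fractional part. The fractional part is a difference of
two registers on the circle ℚ/ℤ: current time minus time stamp, or receiver time minus sender time.
The natural number is the counter in the case of a channel, and is known up to unary equivalence in
the case of a local clock. Since only differences of registers matter, absolute time is forgotten.
This makes the final rotation sound; it is also needed, because a run may end with aligned nonzero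
registers whereas acceptance requires zeros.

Under the invariant all constraints agree (the `sat_*` lemmas). Unary classes decide inequality and
modular tests with threshold and modulus `M`, and cyclic order formulas decide comparisons of
fractional parts. A send constraint forces the channel clock to start at exactly 0, so the receiver
sees the desynchronisation itself. The condition that no receiver is behind a sender is the
nonnegativity of the counters.

The core is the elapse of δ in `p`, split as ⌊δ⌋ plus a rest below 1. Whole units leave the
registers alone. The rest moves the register of `p` along an arc, and an integral part changes
exactly when the arc meets the other register involved. The arc is open at the old time for clocks
and incoming channels, and open at the new time for outgoing ones; `fract_add_fract_eq_K₁` and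
`fract_sub_fract_eq_K₂` are the exact carry and borrow rules behind this.

From the rendezvous side, each step becomes a path, and decrements are possible because the target
configuration is ordered. Conversely, the rendezvous configuration waits while the automaton passes
through temporary locations; the elapsed time is accumulated and spent in one step at the end. -/

/-! ### Paths, simulations and pointwise updates. -/

theorem LTS.Path.append {A : LTS.{u}} {c d e : A.Config} {w w' : List A.Action}
    (h : A.Path c w d) (h' : A.Path d w' e) : A.Path c (w ++ w') e := by
  induction h with
  | nil => exact h'
  | cons hs _ ih => exact .cons hs (ih h')

theorem LTS.Path.single {A : LTS.{u}} {c d : A.Config} {a : A.Action} (h : A.step c a d) :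
    A.Path c [a] d :=
  .cons h (.nil d)

/-- If every step of `A` is simulated by a path of `B`, then so is every path of `A`. -/
theorem LTS.Path.simulate {A B : LTS.{u}} (R : A.Config → B.Config → Prop)
    (hR : ∀ s t a s', R s t → A.step s a s' → ∃ w t', B.Path t w t' ∧ R s' t')
    {s s' : A.Config} {w : List A.Action} (h : A.Path s w s') {t : B.Config} (ht : R s t) :
    ∃ w' t', B.Path t w' t' ∧ R s' t' := by
  induction h generalizing t with
  | nil => exact ⟨[], t, .nil t, ht⟩
  | cons hs _ ih =>
    obtain ⟨w₁, t₁, h₁, hr₁⟩ := hR _ _ _ _ ht hs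
    obtain ⟨w₂, t₂, h₂, hr₂⟩ := ih hr₁
    exact ⟨_, t₂, h₁.append h₂, hr₂⟩

@[simp]
theorem setAt_same {ι : Type*} {β : ι → Type*} (f : ∀ i, β i) (i : ι) (b : β i) :
    setAt f i b i = b :=
  by classical exact Function.update_self ..

theorem setAt_of_ne {ι : Type*} {β : ι → Type*} (f : ∀ i, β i) {i j : ι} (b : β i) (h : j ≠ i) :
    setAt f i b j = f j :=
  by classical exact Function.update_of_ne h ..

@[simp]
theorem setAt_setAt {ι : Type*} {β : ι → Type*} (f : ∀ i, β i) (i : ι) (b b' : β i) :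
    setAt (setAt f i b) i b' = setAt f i b' :=
  by classical exact Function.update_idem ..

@[simp]
theorem setAt_eq_self {ι : Type*} {β : ι → Type*} (f : ∀ i, β i) (i : ι) :
    setAt f i (f i) = f :=
  by classical exact Function.update_eq_self ..

/-! ### Cyclic order formulas and fractional parts of differences. -/

namespace RegFormula

variable {R : Type u}

theorem sat_all {ι : Type*} [Finite ι] (f : ι → RegFormula R) (r : R → UnitIco) :
    (all f).Sat r ↔ ∀ i, (f i).Sat r := by
  have key : ∀ L : List ι, ((L.map f).foldr conj tt).Sat r ↔ ∀ i ∈ L, (f i).Sat r := by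
    intro L
    induction L with
    | nil => simp [Sat]
    | cons i L ih => simp [Sat, ih]
  simp [all, key]

theorem fract_sub_unitIco (a b : UnitIco) :
    Int.fract ((a : ℚ) - b) = if (b : ℚ) ≤ a then (a : ℚ) - b else a - b + 1 := by
  have ha := a.2
  have hb := b.2
  rw [Set.mem_Ico] at ha hb
  split_ifs with h
  · exact Int.fract_eq_self.2 ⟨by linarith, by linarith⟩
  · rw [← Int.fract_add_one ((a : ℚ) - b)]
    exact Int.fract_eq_self.2 ⟨by linarith, by linarith⟩

theorem fract_sub_eq_zero_iff (a b : UnitIco) : Int.fract ((a : ℚ) - b) = 0 ↔ a = b := by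
  have ha := a.2
  have hb := b.2
  rw [Set.mem_Ico] at ha hb
  rw [fract_sub_unitIco, Subtype.ext_iff]
  grind

theorem sat_K₀ (r : R → UnitIco) (a b c : R) :
    (K₀ a b c).Sat r ↔ Int.fract ((r c : ℚ) - r b) ≤ Int.fract ((r c : ℚ) - r a) := by
  simp only [K₀, Sat, CycOrd, fract_sub_unitIco, ← Subtype.coe_lt_coe, Subtype.ext_iff]
  have ha := (r a).2
  have hb := (r b).2
  have hc := (r c).2
  rw [Set.mem_Ico] at ha hb hc
  grind

theorem sat_cmp (r : R → UnitIco) (o a b : R) (c : Cmp) :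
    (cmp o a b c).Sat r ↔
      c.Holds (Int.fract ((r o : ℚ) - r a)) (Int.fract ((r o : ℚ) - r b)) := by
  cases c <;> simp only [cmp, Sat, sat_K₀, Cmp.Holds, not_le, le_antisymm_iff]

open Classical in
-- Carry rule: with old time `u`, time stamp `v` and new time `w`, both sides agree modulo 1, and
-- the age of the stamp passes an integer iff `v` lies in the arc from `u` (excluded) to `w`
-- (included).
theorem fract_add_fract_eq_K₁ (r : R → UnitIco) (u v w : R) :
    Int.fract ((r u : ℚ) - r v) + Int.fract ((r w : ℚ) - r u) =
      (if (K₁ u v w).Sat r then 1 else 0) + Int.fract ((r w : ℚ) - r v) := by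
  simp only [K₁, Sat, CycOrd, fract_sub_unitIco, ← Subtype.coe_lt_coe, Subtype.ext_iff]
  have ha := (r u).2
  have hb := (r v).2
  have hc := (r w).2
  rw [Set.mem_Ico] at ha hb hc
  grind

open Classical in
-- Borrow rule: the lead of a receiver at `v` shrinks as the sender moves from `u` to `w`. A unit
-- must be borrowed iff the sender goes strictly past `v`, so here `u` is included in the arc and
-- `w` excluded.
theorem fract_sub_fract_eq_K₂ (r : R → UnitIco) (u v w : R) :
    Int.fract ((r v : ℚ) - r u) + (if (K₂ u v w).Sat r then 1 else 0) =
      Int.fract ((r v : ℚ) - r w) + Int.fract ((r w : ℚ) - r u) := by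
  simp only [K₂, Sat, CycOrd, fract_sub_unitIco, ← Subtype.coe_lt_coe, Subtype.ext_iff]
  have ha := (r u).2
  have hb := (r v).2
  have hc := (r w).2
  rw [Set.mem_Ico] at ha hb hc
  grind

end RegFormula

/-! ### Effect of sequences of operations. -/

namespace RacOp

variable {R N : Type u}

theorem seqStep_append (w w' : List (RacOp R N)) (d e) :
    SeqStep (w ++ w') d e ↔ ∃ f, SeqStep w d f ∧ SeqStep w' f e := by
  induction w generalizing d with
  | nil => simp [SeqStep]
  | cons o w ih =>
    simp only [List.cons_append, SeqStep, ih]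
    constructor
    · rintro ⟨f, hf, g, hg, he⟩
      exact ⟨g, ⟨f, hf, hg⟩, he⟩
    · rintro ⟨g, ⟨f, hf, hg⟩, he⟩
      exact ⟨f, hf, g, hg, he⟩

theorem seqStep_cons (o : RacOp R N) (w : List (RacOp R N)) (d e) :
    SeqStep (o :: w) d e ↔ ∃ f, Step o d f ∧ SeqStep w f e := Iff.rfl

theorem seqStep_nil (d e : (N → ℕ) × (R → UnitIco)) : SeqStep [] d e ↔ d = e := Iff.rfl

theorem seqStep_singleton (o : RacOp R N) (d e) : SeqStep [o] d e ↔ Step o d e := by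
  simp [SeqStep]

theorem step_nop (d e : (N → ℕ) × (R → UnitIco)) : Step .nop d e ↔ d = e :=
  ⟨by rintro ⟨⟩; rfl, by rintro rfl; exact .nop _ _⟩

theorem step_guess (a : R) (d e : (N → ℕ) × (R → UnitIco)) :
    Step (.guess a) d e ↔ ∃ t, e = (d.1, setAt d.2 a t) :=
  ⟨by rintro ⟨⟩; exact ⟨_, rfl⟩, by rintro ⟨t, rfl⟩; exact .guess _ _ _ t⟩

theorem step_test (φ : RegFormula R) (d e : (N → ℕ) × (R → UnitIco)) :
    Step (.test φ) d e ↔ φ.Sat d.2 ∧ d = e :=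
  ⟨by rintro ⟨⟩; exact ⟨‹_›, rfl⟩, by rintro ⟨h, rfl⟩; exact .test _ _ _ h⟩

theorem step_testIneq (i : N) (c k) (d e : (N → ℕ) × (R → UnitIco)) :
    Step (.testIneq i c k) d e ↔ c.Holds (d.1 i : ℤ) k ∧ d = e :=
  ⟨by rintro ⟨⟩; exact ⟨‹_›, rfl⟩, by rintro ⟨h, rfl⟩; exact .testIneq _ _ _ _ _ h⟩

theorem step_testMod (i : N) (m hm k) (d e : (N → ℕ) × (R → UnitIco)) :
    Step (.testMod i m hm k) d e ↔ (d.1 i : ℤ) ≡ k [ZMOD m] ∧ d = e :=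
  ⟨by rintro ⟨⟩; exact ⟨‹_›, rfl⟩, by rintro ⟨h, rfl⟩; exact .testMod _ _ _ _ _ _ h⟩

theorem step_inc (i : N) (d e : (N → ℕ) × (R → UnitIco)) :
    Step (.inc i) d e ↔ e = (setAt d.1 i (d.1 i + 1), d.2) :=
  ⟨by rintro ⟨⟩; rfl, by rintro rfl; exact .inc _ _ _⟩

theorem step_dec (i : N) (d e : (N → ℕ) × (R → UnitIco)) :
    Step (.dec i) d e ↔ 0 < d.1 i ∧ e = (setAt d.1 i (d.1 i - 1), d.2) :=
  ⟨by rintro ⟨⟩; exact ⟨‹_›, rfl⟩, by rintro ⟨h, rfl⟩; exact .dec _ _ _ h⟩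

open Classical in
theorem seqStep_incAll [Finite N] (A : Set N) (d e : (N → ℕ) × (R → UnitIco)) :
    SeqStep (incAll A) d e ↔ e.2 = d.2 ∧ ∀ i, e.1 i = d.1 i + if i ∈ A then 1 else 0 := by
  have key : ∀ L : List N, L.Nodup → ∀ d, SeqStep (L.map .inc) d e ↔
      e.2 = d.2 ∧ ∀ i, e.1 i = d.1 i + if i ∈ L then 1 else 0 := by
    intro L hL
    induction L with
    | nil => intro d; simp [SeqStep, Prod.ext_iff, funext_iff]; grind
    | cons j L ih =>
      intro d
      obtain ⟨hj, hL⟩ := List.nodup_cons.1 hL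
      simp only [List.map_cons, seqStep_cons, step_inc, exists_eq_left, ih hL]
      refine and_congr_right fun _ => forall_congr' fun i => ?_
      by_cases hi : i = j
      · subst hi; simp [hj]
      · simp [hi, setAt_of_ne]
  simpa [incAll] using key _ (Set.toFinite A).toFinset.nodup_toList d

open Classical in
-- The additive form avoids truncated subtraction and encodes the positivity checks: over ℕ the
-- equation has a solution at `i ∈ A` only if the old counter is positive. The enumeration has no
-- duplicates, so each counter drops by one only.
theorem seqStep_decAll [Finite N] (A : Set N) (d e : (N → ℕ) × (R → UnitIco)) :
    SeqStep (decAll A) d e ↔ e.2 = d.2 ∧ ∀ i, e.1 i + (if i ∈ A then 1 else 0) = d.1 i := by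
  have key : ∀ L : List N, L.Nodup → ∀ d, SeqStep (L.map .dec) d e ↔
      e.2 = d.2 ∧ ∀ i, e.1 i + (if i ∈ L then 1 else 0) = d.1 i := by
    intro L hL
    induction L with
    | nil => intro d; simp [SeqStep, Prod.ext_iff, funext_iff]; grind
    | cons j L ih =>
      intro d
      obtain ⟨hj, hL⟩ := List.nodup_cons.1 hL
      simp only [List.map_cons, seqStep_cons, step_dec, and_assoc, exists_and_left, exists_eq_left,
        ih hL]
      constructor
      · rintro ⟨h0, h1, h2⟩
        refine ⟨h1, fun i => ?_⟩
        have := h2 i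
        by_cases hi : i = j
        · subst hi; simp [hj] at this ⊢; omega
        · simpa [hi, setAt_of_ne] using this
      · rintro ⟨h1, h2⟩
        have h0 := h2 j
        simp only [List.mem_cons, true_or, if_true] at h0
        refine ⟨by omega, h1, fun i => ?_⟩
        have := h2 i
        by_cases hi : i = j
        · subst hi; simp [hj]; omega
        · simpa [hi, setAt_of_ne] using this
  simpa [decAll] using key _ (Set.toFinite A).toFinset.nodup_toList d

open Classical in
theorem seqStep_incAll_decAll [Finite N] (A B : Set N) (d e : (N → ℕ) × (R → UnitIco)) :
    SeqStep (incAll A ++ decAll B) d e ↔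
      e.2 = d.2 ∧ ∀ i, e.1 i + (if i ∈ B then 1 else 0) = d.1 i + if i ∈ A then 1 else 0 := by
  simp only [seqStep_append, seqStep_incAll, seqStep_decAll]
  constructor
  · rintro ⟨f, ⟨h1, h2⟩, h3, h4⟩
    exact ⟨h3.trans h1, fun i => (h4 i).trans (h2 i)⟩
  · rintro ⟨h1, h2⟩
    exact ⟨(fun i => d.1 i + if i ∈ A then 1 else 0, d.2), ⟨rfl, fun _ => rfl⟩, h1, h2⟩

theorem seqStep_guessAll [Finite R] (d e : (N → ℕ) × (R → UnitIco)) :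
    SeqStep guessAll d e ↔ e.1 = d.1 := by
  have key : ∀ L : List R, ∀ d, SeqStep (L.map .guess) d e ↔
      e.1 = d.1 ∧ ∀ a ∉ L, e.2 a = d.2 a := by
    intro L
    induction L with
    | nil => intro d; simp [SeqStep, Prod.ext_iff, funext_iff]; grind
    | cons b L ih =>
      intro d
      simp only [List.map_cons, seqStep_cons, step_guess, ih]
      constructor
      · rintro ⟨_, ⟨t, rfl⟩, h1, h2⟩
        refine ⟨h1, fun a ha => ?_⟩
        simp only [List.mem_cons, not_or] at ha
        rw [h2 a ha.2]
        exact setAt_of_ne _ _ ha.1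
      · rintro ⟨h1, h2⟩
        -- Guessing the final value of `b` at once also works if `b` occurs again in `L`.
        refine ⟨_, ⟨e.2 b, rfl⟩, h1, fun a ha => ?_⟩
        by_cases hab : a = b
        · subst hab; simp
        · rw [h2 a (by simp [hab, ha])]
          exact (setAt_of_ne _ _ hab).symm
  simpa [guessAll] using key (Set.finite_univ (α := R)).toFinset.toList d

end RacOp

/-! ### Unary classes and clock values. -/

theorem UnaryEquiv.holds {M a b : ℕ} (h : UnaryEquiv M a b) {k : ℤ} (hk : k ≤ M) {c : Cmp}
    (hc : c.Holds (a : ℚ) k) : c.Holds (b : ℚ) k := by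
  obtain ⟨h1, h2, -⟩ := h
  cases c <;> simp only [Cmp.Holds] at hc ⊢ <;> norm_cast at hc ⊢ <;> omega

theorem UnaryEquiv.modEq {M a b : ℕ} (h : UnaryEquiv M a b) {k : ℤ}
    (hk : (a : ℤ) ≡ k [ZMOD M]) : (b : ℤ) ≡ k [ZMOD M] :=
  ((Int.natCast_modEq_iff.2 h.2.2).symm).trans hk

namespace UnaryClass

/-- The class of a natural number. -/
def ofNat (M m : ℕ) : UnaryClass M := Quotient.mk (unarySetoid M) m

theorem of_eq_ofNat (M : ℕ) (v : ℚ≥0) : of M v = ofNat M ⌊v⌋₊ := rfl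

theorem succ_ofNat (M m : ℕ) : (ofNat M m).succ = ofNat M (m + 1) := rfl

theorem ofNat_eq_iff {M a b : ℕ} : ofNat M a = ofNat M b ↔ UnaryEquiv M a b :=
  Quotient.eq (r := unarySetoid M)

/-- Zero never exceeds the threshold, so its class is a singleton. Hence a class in the final
location determines the integral part exactly. -/
theorem ofNat_eq_zero_iff {M a : ℕ} : ofNat M a = ofNat M 0 ↔ a = 0 := by
  rw [ofNat_eq_iff]
  constructor
  · rintro ⟨h1, h2, -⟩
    omega
  · rintro rfl
    exact ⟨fun _ _ => rfl, Iff.rfl, rfl⟩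

end UnaryClass

theorem Cmp.holds_intCast (c : Cmp) (a b : ℤ) : c.Holds (a : ℚ) b ↔ c.Holds a b := by
  cases c <;> simp [Cmp.Holds]

theorem ClockKind.value_integral (v : ℚ≥0) :
    ClockKind.integral.value v = ((⌊v⌋₊ : ℕ) : ℚ) := by
  have : ⌊(v : ℚ)⌋ = ((⌊v⌋₊ : ℕ) : ℤ) := by
    rw [Int.floor_eq_iff]
    exact_mod_cast (⟨Nat.floor_le (zero_le : 0 ≤ v), Nat.lt_floor_add_one v⟩ :
      (⌊v⌋₊ : ℚ≥0) ≤ v ∧ v < (⌊v⌋₊ : ℚ≥0) + 1)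
  rw [ClockKind.value, this, Int.cast_natCast]

/-- On its domain a clock equals the value to which it evaluates in constraints (floor on ℕ,
fractional part on [0, 1)), so no information is lost. -/
theorem Constraint.sat_isZero_iff {X : Type u} {kind : X → ClockKind} {μ : X → ℚ≥0} {x : X}
    (hx : kind x ≠ .classical) (hdom : (kind x).Domain (μ x)) :
    (isZero kind x).Sat μ ↔ μ x = 0 := by
  cases hk : kind x with
  | classical => exact absurd hk hx
  | fractional =>
    rw [hk] at hdom
    have h0 : Int.fract (μ x : ℚ) = μ x :=
      Int.fract_eq_self.2 ⟨(μ x).2, by exact_mod_cast (hdom : μ x < 1)⟩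
    simp [isZero, hk, Sat, Atom.Sat, Cmp.Holds, ClockKind.value, h0]
  | integral =>
    rw [hk] at hdom
    obtain ⟨n, hn⟩ := hdom
    simp [isZero, hk, Sat, Atom.Sat, Cmp.Holds, ClockKind.value, hn]

theorem ClockKind.domain_zero (k : ClockKind) : k.Domain 0 := by
  cases k
  · trivial
  · exact ⟨0, by simp⟩
  · exact zero_lt_one

theorem TCA.ne_of_chan {S : TCA.{u}} (hchan : ∀ p, ¬ S.chan p p) {p q : S.Proc} (h : S.chan p q) :
    p ≠ q := by
  rintro rfl
  exact hchan _ h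

/-! ### Configurations described by classes, counters and registers. -/

namespace TCA

variable {S : TCA.{u}} {M : ℕ}

open Classical in
/-- The configuration in which the time of `p` has advanced by `δ`. -/
noncomputable def RvConfig.delay (c : S.RvConfig) (p : S.Proc) (δ : ℚ≥0) : S.RvConfig :=
  ⟨c.loc, fun x => if x.1 = p then c.val x + δ else c.val x, setAt c.now p (c.now p + δ)⟩

theorem RvConfig.delay_zero (c : S.RvConfig) (p : S.Proc) : c.delay p 0 = c := by
  simp [delay]

theorem RvConfig.delay_delay (c : S.RvConfig) (p : S.Proc) (δ ε : ℚ≥0) :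
    (c.delay p δ).delay p ε = c.delay p (δ + ε) := by
  simp only [delay, setAt_same, setAt_setAt, add_assoc, RvConfig.mk.injEq, true_and, and_true]
  funext x
  split_ifs <;> simp [add_assoc]

/-- A unary class, counters and registers describe the clock values of a configuration; the
registers may have been rotated. -/
structure Describes (l : S.Unary M) (n : S.Chan → ℕ) (r : S.TReg → UnitIco)
    (c : S.RvConfig) : Prop where
  clk : ∀ x, ∃ m : ℕ, l x = UnaryClass.ofNat M m ∧
    (c.val x : ℚ) = m + Int.fract ((r (.ref x.1) : ℚ) - r (.clk x))
  chan : ∀ e : S.Chan, (c.now e.1.2 : ℚ) =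
    c.now e.1.1 + (n e + Int.fract ((r (.ref e.1.2) : ℚ) - r (.ref e.1.1)))

theorem floor_natCast_add_fract {v : ℚ≥0} {m : ℕ} {t : ℚ} (h : (v : ℚ) = m + Int.fract t) :
    ⌊v⌋₊ = m := by
  rw [Nat.floor_eq_iff zero_le]
  have h0 := Int.fract_nonneg t
  have h1 := Int.fract_lt_one t
  constructor
  · have : (m : ℚ) ≤ v := by linarith
    exact_mod_cast this
  · have : (v : ℚ) < m + 1 := by linarith
    exact_mod_cast this

theorem fract_natCast_add_fract {v : ℚ≥0} {m : ℕ} {t : ℚ} (h : (v : ℚ) = m + Int.fract t) :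
    Int.fract (v : ℚ) = Int.fract t := by
  rw [h, Int.fract_natCast_add, Int.fract_fract]

theorem sat_wrapCheck {p : S.Proc} {Y : Set S.TReg} {r : S.TReg → UnitIco} :
    (S.wrapCheck p Y).Sat r ↔
      (∀ a ∈ S.plusRegs p, a ∈ Y ↔ (RegFormula.K₁ (.aux p) a (.ref p)).Sat r) ∧
      ∀ a ∈ S.minusRegs p, a ∈ Y ↔ (RegFormula.K₂ (.aux p) a (.ref p)).Sat r := by
  have key : ∀ (P Q : Prop) [Decidable P] [Decidable Q] (φ : RegFormula S.TReg),
      (if P then (if Q then φ else .neg φ) else .tt).Sat r ↔ (P → (Q ↔ φ.Sat r)) := by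
    intro P Q _ _ φ
    split_ifs <;> simp [RegFormula.Sat, *]
  rw [wrapCheck, RegFormula.sat_all]
  simp only [RegFormula.Sat, key, forall_and]

theorem sat_aligned {r : S.TReg → UnitIco} :
    S.aligned.Sat r ↔ (∀ x, r (.clk x) = r (.ref x.1)) ∧
      ∀ e : S.Chan, r (.ref e.1.1) = r (.ref e.1.2) := by
  simp only [aligned, RegFormula.Sat, RegFormula.sat_all]

/-! ### Preservation of the description under delay, reset and rotation. -/

namespace Describes

variable {l : S.Unary M} {n : S.Chan → ℕ} {r : S.TReg → UnitIco} {c : S.RvConfig}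

theorem congr_regs (h : Describes l n r c) {r' : S.TReg → UnitIco}
    (hclk : ∀ x, r' (.clk x) = r (.clk x)) (href : ∀ p, r' (.ref p) = r (.ref p)) :
    Describes l n r' c := by
  constructor
  · simpa only [hclk, href] using h.clk
  · simpa only [hclk, href] using h.chan

theorem of_val (h : Describes l n r c) (x : S.LocalClk) : UnaryClass.of M (c.val x) = l x := by
  obtain ⟨m, hm, hv⟩ := h.clk x
  rw [hm, UnaryClass.of_eq_ofNat, floor_natCast_add_fract hv]

theorem fract_val (h : Describes l n r c) (x : S.LocalClk) :
    Int.fract (c.val x : ℚ) = Int.fract ((r (.ref x.1) : ℚ) - r (.clk x)) := by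
  obtain ⟨m, hm, hv⟩ := h.clk x
  exact fract_natCast_add_fract hv

/-- Counters are natural numbers and fractional parts are nonnegative, so the side condition on
rendezvous configurations comes for free. -/
theorem ordered (h : Describes l n r c) : c.Ordered := by
  intro p q hpq
  have := h.chan ⟨(p, q), hpq⟩
  have h0 := Int.fract_nonneg ((r (.ref q) : ℚ) - r (.ref p))
  have h1 : (0 : ℚ) ≤ n ⟨(p, q), hpq⟩ := Nat.cast_nonneg _
  have h2 : (c.now p : ℚ) ≤ c.now q := by
    simp only at this
    linarith
  exact_mod_cast h2

theorem desync (h : Describes l n r c) (e : S.Chan) {δ : ℚ≥0} (hδ : c.now e.1.2 = c.now e.1.1 + δ) :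
    (δ : ℚ) = n e + Int.fract ((r (.ref e.1.2) : ℚ) - r (.ref e.1.1)) := by
  have := h.chan e
  rw [hδ] at this
  push_cast at this
  linarith

open Classical in
/-- Time may elapse in `p` if registers and counters are updated accordingly. -/
theorem delay_of (h : Describes l n r c) (p : S.Proc) (δ : ℚ≥0) (hchan : ∀ p, ¬ S.chan p p)
    {A : Set S.LocalClk} {I O : Set S.Chan} {n' : S.Chan → ℕ} {r' : S.TReg → UnitIco}
    (hn : ∀ e, n' e + (if e ∈ O then 1 else 0) = n e + if e ∈ I then 1 else 0)
    (hclk : ∀ x, r' (.clk x) = r (.clk x)) (href : ∀ q, q ≠ p → r' (.ref q) = r (.ref q))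
    (hAp : A ⊆ S.clocksOf p) (hIp : I ⊆ S.incoming p) (hOp : O ⊆ S.outgoing p)
    (hA : ∀ x ∈ S.clocksOf p, Int.fract ((r (.ref p) : ℚ) - r (.clk x)) + δ =
      (if x ∈ A then 1 else 0) + Int.fract ((r' (.ref p) : ℚ) - r (.clk x)))
    (hI : ∀ e ∈ S.incoming p, Int.fract ((r (.ref p) : ℚ) - r (.ref e.1.1)) + δ =
      (if e ∈ I then 1 else 0) + Int.fract ((r' (.ref p) : ℚ) - r (.ref e.1.1)))
    (hO : ∀ e ∈ S.outgoing p, Int.fract ((r (.ref e.1.2) : ℚ) - r (.ref p)) +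
      (if e ∈ O then 1 else 0) = Int.fract ((r (.ref e.1.2) : ℚ) - r' (.ref p)) + δ) :
    Describes (l.bump A) n' r' (c.delay p δ) := by
  constructor
  · intro x
    obtain ⟨m, hm, hv⟩ := h.clk x
    by_cases hx : x.1 = p
    · have hA := hA x hx
      rw [hx] at hv
      refine ⟨m + if x ∈ A then 1 else 0, ?_, ?_⟩
      · rw [Unary.bump, hm]
        by_cases hxA : x ∈ A
        · simp only [if_pos hxA, UnaryClass.succ_ofNat]
        · simp only [if_neg hxA, add_zero]
      · simp only [RvConfig.delay, hclk, hx, if_true]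
        push_cast
        linarith
    · have hxA : x ∉ A := fun hxA => hx (hAp hxA)
      exact ⟨m, by rw [Unary.bump, if_neg hxA, hm],
        by simpa only [RvConfig.delay, if_neg hx, hclk, href _ hx] using hv⟩
  · intro e
    have hc := h.chan e
    have hne : ((n' e : ℚ) + if e ∈ O then 1 else 0) = n e + if e ∈ I then 1 else 0 := by
      exact_mod_cast hn e
    obtain ⟨⟨s, t⟩, hst⟩ := e
    simp only at hc
    -- Without self-channels at most one end of the channel moves: `p` is the sender, the receiver
    -- or neither.
    have hne' := ne_of_chan hchan hst
    by_cases hs : s = p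
    · subst hs
      have hI' : (⟨(s, t), hst⟩ : S.Chan) ∉ I := fun h' => hne'.symm (hIp h')
      have := hO ⟨(s, t), hst⟩ rfl
      simp only [RvConfig.delay, setAt_same, setAt_of_ne _ _ hne'.symm, href t hne'.symm]
      rw [if_neg hI'] at hne
      push_cast
      linarith
    · have hO' : (⟨(s, t), hst⟩ : S.Chan) ∉ O := fun h' => hs (hOp h')
      rw [if_neg hO'] at hne
      by_cases ht : t = p
      · subst ht
        have := hI ⟨(s, t), hst⟩ rfl
        simp only [RvConfig.delay, setAt_same, setAt_of_ne _ _ hne', href s hne']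
        push_cast
        linarith
      · have hI' : (⟨(s, t), hst⟩ : S.Chan) ∉ I := fun h' => ht (hIp h')
        rw [if_neg hI'] at hne
        simp only [RvConfig.delay, setAt_of_ne _ _ hs, setAt_of_ne _ _ ht, href s hs, href t ht]
        linarith

open Classical in
-- A whole unit is a full turn of the circle: no register moves and every affected integral part
-- changes by one.
theorem delay_one (h : Describes l n r c) (p : S.Proc) (hchan : ∀ p, ¬ S.chan p p)
    {n' : S.Chan → ℕ} (hn : ∀ e, n' e + (if e ∈ S.outgoing p then 1 else 0) =
      n e + if e ∈ S.incoming p then 1 else 0) :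
    Describes (l.bump (S.clocksOf p)) n' r (c.delay p 1) := by
  refine h.delay_of p 1 hchan hn (fun _ => rfl) (fun _ _ => rfl) subset_rfl subset_rfl subset_rfl
    ?_ ?_ ?_
  · intro x hx
    rw [if_pos hx]
    push_cast
    ring
  · intro e he
    rw [if_pos he]
    push_cast
    ring
  · intro e he
    rw [if_pos he]
    push_cast
    ring

open Classical in
/-- The time of `p` moves forward to the next moment at which its register has the given value. -/
theorem delay_fract (h : Describes l n r c) (p : S.Proc) (hchan : ∀ p, ¬ S.chan p p)
    {n' : S.Chan → ℕ} {r' : S.TReg → UnitIco}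
    (hclk : ∀ x, r' (.clk x) = r (.clk x)) (href : ∀ q, q ≠ p → r' (.ref q) = r (.ref q))
    (haux : r' (.aux p) = r (.ref p)) {δ : ℚ≥0}
    (hδ : (δ : ℚ) = Int.fract ((r' (.ref p) : ℚ) - r (.ref p))) {Y : Set S.TReg}
    (hY : (S.wrapCheck p Y).Sat r')
    {I O : Set S.Chan} (hI : I = {e | e ∈ S.incoming p ∧ .ref e.1.1 ∈ Y})
    (hO : O = {e | e ∈ S.outgoing p ∧ .ref e.1.2 ∈ Y})
    (hn : ∀ e, n' e + (if e ∈ O then 1 else 0) = n e + if e ∈ I then 1 else 0) :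
    Describes (l.bump {x | x ∈ S.clocksOf p ∧ .clk x ∈ Y}) n' r' (c.delay p δ) := by
  obtain ⟨hplus, hminus⟩ := sat_wrapCheck.1 hY
  refine h.delay_of p δ hchan hn hclk href (fun _ h => h.1)
    (by rw [hI]; exact fun _ h => h.1) (by rw [hO]; exact fun _ h => h.1) ?_ ?_ ?_
  · intro x hx
    -- In `r'` the register `aux p` holds the old time and `ref p` the new one, so the carry rule
    -- applies to the time stamp.
    have := RegFormula.fract_add_fract_eq_K₁ r' (.aux p) (.clk x) (.ref p)
    rw [haux, hclk] at this
    have hm : TReg.clk x ∈ S.plusRegs p := .inl ⟨x, hx, rfl⟩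
    simp only [Set.mem_ofPred_eq, hx, true_and, hplus _ hm]
    rw [hδ, this]
  · intro e he
    have := RegFormula.fract_add_fract_eq_K₁ r' (.aux p) (.ref e.1.1) (.ref p)
    have hne : e.1.1 ≠ p := fun h' => ne_of_chan hchan e.2 (h'.trans (Eq.symm he))
    rw [haux, href _ hne] at this
    have hm : TReg.ref e.1.1 ∈ S.plusRegs p := .inr ⟨e, he, rfl⟩
    simp only [hI, Set.mem_ofPred_eq, he, true_and, hplus _ hm]
    rw [hδ, this]
  · intro e he
    have := RegFormula.fract_sub_fract_eq_K₂ r' (.aux p) (.ref e.1.2) (.ref p)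
    have hne : e.1.2 ≠ p := fun h' => ne_of_chan hchan e.2 (Eq.trans he h'.symm)
    rw [haux, href _ hne] at this
    have hm : TReg.ref e.1.2 ∈ S.minusRegs p := ⟨e, he, rfl⟩
    simp only [hO, Set.mem_ofPred_eq, he, true_and, hminus _ hm]
    rw [hδ, this]

theorem reset (h : Describes l n r c) (p : S.Proc) (x : S.Clk p) (ℓ : ∀ p, S.Loc p) :
    Describes (setAt l ⟨p, x⟩ (UnaryClass.of M 0)) n (setAt r (.clk ⟨p, x⟩) (r (.ref p)))
      ⟨ℓ, setAt c.val ⟨p, x⟩ 0, c.now⟩ := by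
  have href : ∀ q, setAt r (.clk ⟨p, x⟩) (r (.ref p)) (.ref q) = r (.ref q) :=
    fun q => setAt_of_ne _ _ (by simp)
  constructor
  · intro y
    rw [href]
    by_cases hy : y = ⟨p, x⟩
    · subst hy
      exact ⟨0, by simp [UnaryClass.of_eq_ofNat], by simp⟩
    · rw [setAt_of_ne _ _ hy, setAt_of_ne _ _ (by simpa using hy)]
      simp only [setAt_of_ne _ _ hy]
      exact h.clk y
  · intro e
    rw [href, href]
    exact h.chan e

/-- Alignment, before and after, makes every difference of registers used by the description zero.
-/
theorem rotate (h : Describes l n r c) (hr : S.aligned.Sat r) {r' : S.TReg → UnitIco}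
    (hr' : S.aligned.Sat r') : Describes l n r' c := by
  rw [sat_aligned] at hr hr'
  constructor
  · intro x
    obtain ⟨m, hm, hv⟩ := h.clk x
    refine ⟨m, hm, ?_⟩
    rw [hv, hr.1 x, hr'.1 x]
    simp
  · intro e
    rw [h.chan e, hr.2 e, hr'.2 e]
    simp

/-! ### Agreement of clock constraints with automaton tests. -/

/-- The described valuation is itself a representative of the class; conversely, the bound `k ≤ M`
makes the test independent of the representative. -/
theorem sat_ineq (h : Describes l n r c) {p : S.Proc} {x : S.Clk p} (hx) (s : Cmp) {k : ℤ}
    (hx' : S.kind p x ≠ .classical) (hk : k ≤ M) :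
    l.Sat (p := p) (.atom (.ineq x hx s k)) ↔
      Constraint.Sat (fun x => c.val ⟨p, x⟩) (.atom (.ineq x hx s k)) := by
  refine ⟨?_, fun hs => ⟨c.val, funext h.of_val, hs⟩⟩
  rintro ⟨μ, hμ, hs⟩
  have hkind : S.kind p x = .integral := by
    cases hk : S.kind p x <;> simp_all
  have he : UnaryEquiv M ⌊μ ⟨p, x⟩⌋₊ ⌊c.val ⟨p, x⟩⌋₊ := by
    rw [← UnaryClass.ofNat_eq_iff]
    exact (congrFun hμ _).trans (h.of_val _).symm
  simp only [Constraint.Sat, Atom.Sat, hkind, ClockKind.value_integral] at hs ⊢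
  exact he.holds hk hs

theorem sat_modular (h : Describes l n r c) {p : S.Proc} {x : S.Clk p} (hx) {m : ℕ} (hm) (k : ℤ)
    (hx' : S.kind p x ≠ .classical) (hmM : m = M) :
    l.Sat (p := p) (.atom (.modular x hx m hm k)) ↔
      Constraint.Sat (fun x => c.val ⟨p, x⟩) (.atom (.modular x hx m hm k)) := by
  refine ⟨?_, fun hs => ⟨c.val, funext h.of_val, hs⟩⟩
  rintro ⟨μ, hμ, hs⟩
  have hkind : S.kind p x = .integral := by
    cases hk : S.kind p x <;> simp_all
  have he : UnaryEquiv M ⌊μ ⟨p, x⟩⌋₊ ⌊c.val ⟨p, x⟩⌋₊ := by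
    rw [← UnaryClass.ofNat_eq_iff]
    exact (congrFun hμ _).trans (h.of_val _).symm
  simp only [Constraint.Sat, Atom.Sat, hkind, ClockKind.value_integral, Int.floor_natCast]
    at hs ⊢
  rw [hmM] at hs ⊢
  exact he.modEq hs

theorem sat_zero (h : Describes l n r c) {p : S.Proc} {x : S.Clk p} (hx) (s : Cmp) :
    Constraint.Sat (kind := S.kind p) (fun x => c.val ⟨p, x⟩) (.atom (.zero x hx s)) ↔
      (RegFormula.cmp (.ref p) (.clk ⟨p, x⟩) (.ref p) s).Sat r := by
  simp [RegFormula.sat_cmp, Constraint.Sat, Atom.Sat, hx, ClockKind.value, h.fract_val]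

theorem sat_order (h : Describes l n r c) {p : S.Proc} {x y : S.Clk p} (hx hy) (s : Cmp) :
    Constraint.Sat (kind := S.kind p) (fun x => c.val ⟨p, x⟩) (.atom (.order x y hx hy s)) ↔
      (RegFormula.cmp (.ref p) (.clk ⟨p, x⟩) (.clk ⟨p, y⟩) s).Sat r := by
  simp [RegFormula.sat_cmp, Constraint.Sat, Atom.Sat, hx, hy, ClockKind.value, h.fract_val]

/-- A channel clock starting at 0 reads δ on receipt, and ⌊δ⌋ is the counter. -/
theorem sat_receive_ineq (h : Describes l n r c) {p q : S.Proc} (hpq : S.chan p q) {δ : ℚ≥0}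
    (hδ : c.now q = c.now p + δ) {κ : S.ChClk p q → ℚ≥0} {x : S.ChClk p q} (hκ : κ x = 0)
    (hx) (hx' : S.chKind p q x ≠ .classical) (s : Cmp) (k : ℤ) (v : S.Clk q → ℚ≥0) :
    Constraint.Sat (kind := Sum.elim (S.kind q) (S.chKind p q)) (Sum.elim v fun x => κ x + δ)
      (.atom (.ineq (.inr x) hx s k)) ↔ s.Holds (n ⟨(p, q), hpq⟩ : ℤ) k := by
  have hkind : S.chKind p q x = .integral := by
    simp only [Sum.elim_inr] at hx
    cases hk : S.chKind p q x <;> simp_all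
  have hfl := floor_natCast_add_fract (h.desync ⟨(p, q), hpq⟩ hδ)
  simp only [Constraint.Sat, Atom.Sat, Sum.elim_inr, hkind, hκ, zero_add,
    ClockKind.value_integral, hfl]
  rw [← Cmp.holds_intCast, Int.cast_natCast]

theorem sat_receive_modular (h : Describes l n r c) {p q : S.Proc} (hpq : S.chan p q) {δ : ℚ≥0}
    (hδ : c.now q = c.now p + δ) {κ : S.ChClk p q → ℚ≥0} {x : S.ChClk p q} (hκ : κ x = 0)
    (hx) (hx' : S.chKind p q x ≠ .classical) (d : ℕ) (hd) (k : ℤ) (v : S.Clk q → ℚ≥0) :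
    Constraint.Sat (kind := Sum.elim (S.kind q) (S.chKind p q)) (Sum.elim v fun x => κ x + δ)
      (.atom (.modular (.inr x) hx d hd k)) ↔ (n ⟨(p, q), hpq⟩ : ℤ) ≡ k [ZMOD d] := by
  have hkind : S.chKind p q x = .integral := by
    simp only [Sum.elim_inr] at hx
    cases hk : S.chKind p q x <;> simp_all
  have hfl := floor_natCast_add_fract (h.desync ⟨(p, q), hpq⟩ hδ)
  simp only [Constraint.Sat, Atom.Sat, Sum.elim_inr, hkind, hκ, zero_add,
    ClockKind.value_integral, hfl, Int.floor_natCast]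

/-- Here the fractional part of δ matters: the register of the sender plays the role of a time stamp
for the channel clock. -/
theorem sat_receive_order (h : Describes l n r c) {p q : S.Proc} (hpq : S.chan p q) {δ : ℚ≥0}
    (hδ : c.now q = c.now p + δ) {κ : S.ChClk p q → ℚ≥0} {x : S.ChClk p q} (hκ : κ x = 0)
    (y : S.Clk q) (hx hy) (s : Cmp) :
    Constraint.Sat (kind := Sum.elim (S.kind q) (S.chKind p q))
      (Sum.elim (fun y => c.val ⟨q, y⟩) fun x => κ x + δ)
      (.atom (.order (.inr x) (.inl y) hx hy s)) ↔
      (RegFormula.cmp (.ref q) (.ref p) (.clk ⟨q, y⟩) s).Sat r := by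
  have hfr := fract_natCast_add_fract (h.desync ⟨(p, q), hpq⟩ hδ)
  simp only [Constraint.Sat, Atom.Sat, hx, hy, ClockKind.value]
  simp only [Sum.elim_inr, Sum.elim_inl, hκ, zero_add, hfr, h.fract_val, RegFormula.sat_cmp]

end Describes

theorem start_describes (r : S.TReg → UnitIco) (hr : ∀ a, r a = UnitIco.zero) (ℓ) :
    Describes (S.zeroUnary M) (fun _ => 0) r (⟨ℓ, fun _ => 0, fun _ => 0⟩ : S.RvConfig) :=
  ⟨fun _ => ⟨0, by simp [zeroUnary, UnaryClass.of_eq_ofNat], by simp [hr]⟩, fun e => by simp [hr]⟩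

end TCA

/-! ### Existence of the new register and counter values. -/

theorem fract_fract_add_sub {a f : ℚ} (h0 : 0 ≤ f) (h1 : f < 1) :
    Int.fract (Int.fract (a + f) - a) = f := by
  have : Int.fract (a + f) - a = f - (⌊a + f⌋ : ℤ) := by
    rw [Int.fract]
    ring
  rw [this, Int.fract_sub_intCast, Int.fract_eq_self.2 ⟨h0, h1⟩]

open Classical in
theorem exists_add_ite_eq {N : Type*} {I O : Set N} {n : N → ℕ} (h : ∀ i ∈ O, 0 < n i) :
    ∃ n' : N → ℕ, ∀ i, n' i + (if i ∈ O then 1 else 0) = n i + if i ∈ I then 1 else 0 := by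
  refine ⟨fun i => (n i + if i ∈ I then 1 else 0) - if i ∈ O then 1 else 0,
    fun i => Nat.sub_add_cancel ?_⟩
  by_cases hi : i ∈ O
  · rw [if_pos hi]
    exact (h i hi).trans_le (Nat.le_add_right _ _)
  · rw [if_neg hi]
    exact Nat.zero_le _

namespace TCA

variable {S : TCA.{u}} {M : ℕ}

theorem toRAC_step [NeZero M] {a b : S.TLoc M} {w : List S.TOp}
    {d e : (S.Chan → ℕ) × (S.TReg → UnitIco)} (h : S.TRule M a w b) (hw : RacOp.SeqStep w d e) :
    (S.toRAC M).sem.step (a, d) w (b, e) :=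
  ⟨h, hw⟩

/- ## From the rendezvous semantics to the register automaton -/

theorem Describes.with_loc {l : S.Unary M} {n : S.Chan → ℕ} {r : S.TReg → UnitIco}
    {c : S.RvConfig} (h : Describes l n r c) (ℓ : ∀ p, S.Loc p) :
    Describes l n r ⟨ℓ, c.val, c.now⟩ :=
  ⟨h.clk, h.chan⟩

section Forward

variable {l : S.Unary M} {n : S.Chan → ℕ} {r : S.TReg → UnitIco} {c : S.RvConfig}

/-- The desynchronisation along an outgoing channel is at least the time that may still elapse. -/
theorem Describes.le_of_ordered_delay (h : Describes l n r c) (hchan : ∀ p, ¬ S.chan p p)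
    {p : S.Proc} {δ : ℚ≥0} (hord : (c.delay p δ).Ordered) {e : S.Chan} (he : e ∈ S.outgoing p) :
    (δ : ℚ) ≤ n e + Int.fract ((r (.ref e.1.2) : ℚ) - r (.ref p)) := by
  obtain ⟨⟨s, t⟩, hst⟩ := e
  obtain rfl : s = p := he
  have hc := h.chan ⟨(s, t), hst⟩
  have ho := hord s t hst
  simp only [RvConfig.delay, setAt_same, setAt_of_ne _ _ (ne_of_chan hchan hst).symm] at ho
  have ho' : (c.now s : ℚ) + δ ≤ c.now t := by exact_mod_cast ho
  simp only at hc ⊢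
  linarith

variable [NeZero M]

open Classical in
theorem path_elapse_units (hchan : ∀ p, ¬ S.chan p p) (ℓ : ∀ p, S.Loc p) (p : S.Proc) (t : S.Loc p)
    (k : ℕ) : ∀ {l : S.Unary M} {n : S.Chan → ℕ} {c : S.RvConfig}, Describes l n r c →
    (c.delay p k).Ordered → ∃ w l' n',
      (S.toRAC M).sem.Path (TLoc.tmp 0 ℓ p t l, n, r) w (TLoc.tmp 0 ℓ p t l', n', r) ∧
      Describes l' n' r (c.delay p k) := by
  induction k with
  | zero =>
    intro l n c h _
    exact ⟨[], l, n, .nil _, by simpa [RvConfig.delay_zero] using h⟩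
  | succ k ih =>
    intro l n c h hord
    -- The final configuration being ordered gives `k + 1 ≤ n e + fract < n e + 1`, hence a positive
    -- counter.
    have hpos : ∀ e ∈ S.outgoing p, 0 < n e := by
      intro e he
      have h1 := h.le_of_ordered_delay hchan hord he
      have h2 := Int.fract_lt_one ((r (.ref e.1.2) : ℚ) - r (.ref p))
      have h3 : (0 : ℚ) ≤ k := Nat.cast_nonneg k
      push_cast at h1
      have h4 : (0 : ℚ) < n e := by linarith
      exact_mod_cast h4
    obtain ⟨n', hn⟩ := exists_add_ite_eq (I := S.incoming p) hpos
    have hk : (c.delay p 1).delay p k = c.delay p ((k + 1 : ℕ) : ℚ≥0) := by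
      rw [RvConfig.delay_delay]
      push_cast
      rw [add_comm]
    rw [← hk] at hord ⊢
    obtain ⟨w, l', n'', hw, hd⟩ := ih (h.delay_one p hchan hn) hord
    exact ⟨_, l', n'', .cons (toRAC_step (.elapseUnit ℓ l p t)
      ((RacOp.seqStep_incAll_decAll _ _ _ (n', r)).2 ⟨rfl, hn⟩)) hw, hd⟩

open Classical in
theorem path_elapse_wrap (hchan : ∀ p, ¬ S.chan p p) (ℓ : ∀ p, S.Loc p) (p : S.Proc) (t : S.Loc p)
    (h : Describes l n r c) {f : ℚ≥0} (hf : f < 1) (hord : (c.delay p f).Ordered) :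
    ∃ w l' n' r',
      (S.toRAC M).sem.Path (TLoc.tmp 0 ℓ p t l, n, r) w (TLoc.main (setAt ℓ p t) l', n', r') ∧
      Describes l' n' r' (c.delay p f) := by
  have hf' : (f : ℚ) < 1 := by exact_mod_cast hf
  -- The value to be guessed for the new time of `p`.
  let v : UnitIco := ⟨Int.fract ((r (.ref p) : ℚ) + f), Int.fract_nonneg _, Int.fract_lt_one _⟩
  let r₁ : S.TReg → UnitIco := setAt r (.aux p) (r (.ref p))
  let r₂ : S.TReg → UnitIco := setAt r₁ (.ref p) v
  have hclk : ∀ x, r₂ (.clk x) = r (.clk x) := fun x =>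
    (setAt_of_ne _ _ (by simp)).trans (setAt_of_ne _ _ (by simp))
  have href : ∀ q, q ≠ p → r₂ (.ref q) = r (.ref q) := fun q hq =>
    (setAt_of_ne _ _ (by simpa using hq)).trans (setAt_of_ne _ _ (by simp))
  have hrefp : r₂ (.ref p) = v := setAt_same ..
  have haux : r₂ (.aux p) = r (.ref p) := (setAt_of_ne _ _ (by simp)).trans (setAt_same ..)
  have hδ : (f : ℚ) = Int.fract ((r₂ (.ref p) : ℚ) - r (.ref p)) := by
    rw [hrefp]
    exact (fract_fract_add_sub f.2 hf').symm
  obtain ⟨Y, hYdef⟩ : ∃ Y : Set S.TReg, Y =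
      {a | (a ∈ S.plusRegs p ∧ (RegFormula.K₁ (.aux p) a (.ref p)).Sat r₂) ∨
        (a ∈ S.minusRegs p ∧ (RegFormula.K₂ (.aux p) a (.ref p)).Sat r₂)} := ⟨_, rfl⟩
  have hYsub : Y ⊆ S.plusRegs p ∪ S.minusRegs p := by
    rw [hYdef]
    rintro a (ha | ha)
    · exact .inl ha.1
    · exact .inr ha.1
  -- A neighbour joined to `p` by channels both ways is tested with both `K₁` and `K₂`, while `Y`
  -- can give one answer only. Being ordered before and after the delay forces `f = 0` in this case,
  -- so old and new time coincide and both formulas fail.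
  have hboth : ∀ a ∈ S.plusRegs p, a ∈ S.minusRegs p →
      ¬ (RegFormula.K₁ (.aux p) a (.ref p)).Sat r₂ ∧
      ¬ (RegFormula.K₂ (.aux p) a (.ref p)).Sat r₂ := by
    rintro a ha ⟨⟨⟨s, q⟩, hpq⟩, hs, rfl⟩
    obtain rfl : s = p := hs
    rcases ha with ⟨x, -, hx⟩ | ⟨⟨⟨q', s'⟩, hqp⟩, hs', hq⟩
    · simp at hx
    obtain rfl : s' = s := hs'
    obtain rfl : q = q' := by simpa using hq
    have h1 := h.ordered q s' hqp
    have h2 := hord s' q hpq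
    simp only [RvConfig.delay, setAt_same, setAt_of_ne _ _ (ne_of_chan hchan hqp)] at h2
    have hf0 : (f : ℚ) = 0 := by
      have h1' : (c.now q : ℚ) ≤ c.now s' := by exact_mod_cast h1
      have h2' : (c.now s' : ℚ) + f ≤ c.now q := by exact_mod_cast h2
      exact le_antisymm (by linarith) f.2
    have heq : r₂ (.ref s') = r₂ (.aux s') := by
      rw [haux, ← RegFormula.fract_sub_eq_zero_iff, ← hδ, hf0]
    simp only [RegFormula.K₁, RegFormula.K₂, RegFormula.Sat, CycOrd, heq]
    grind
  have hY : (S.wrapCheck p Y).Sat r₂ := by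
    rw [sat_wrapCheck, hYdef]
    refine ⟨fun a ha => ?_, fun a ha => ?_⟩
    · exact ⟨fun h => h.elim And.right fun h => absurd h.2 (hboth a ha h.1).2,
        fun h => .inl ⟨ha, h⟩⟩
    · exact ⟨fun h => h.elim (fun h => absurd h.2 (hboth a h.1 ha).1) And.right,
        fun h => .inr ⟨ha, h⟩⟩
  obtain ⟨I, hI⟩ : ∃ I : Set S.Chan, I = {e | e ∈ S.incoming p ∧ .ref e.1.1 ∈ Y} := ⟨_, rfl⟩
  obtain ⟨O, hO⟩ : ∃ O : Set S.Chan, O = {e | e ∈ S.outgoing p ∧ .ref e.1.2 ∈ Y} := ⟨_, rfl⟩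
  -- For an outgoing channel in `O`, the borrow rule makes the old fractional lead of the receiver
  -- smaller than `f`, whereas the whole lead is at least `f`; the counter must supply the
  -- difference.
  have hpos : ∀ e ∈ O, 0 < n e := by
    intro e he
    rw [hO] at he
    obtain ⟨he, heY⟩ := he
    have h1 := h.le_of_ordered_delay hchan hord he
    have h2 := RegFormula.fract_sub_fract_eq_K₂ r₂ (.aux p) (.ref e.1.2) (.ref p)
    have hne : e.1.2 ≠ p := fun h' => ne_of_chan hchan e.2 (Eq.trans he h'.symm)
    rw [if_pos (((sat_wrapCheck.1 hY).2 _ ⟨e, he, rfl⟩).1 heY), haux, href _ hne, ← hδ] at h2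
    have h3 := Int.fract_lt_one ((r (.ref e.1.2) : ℚ) - r₂ (.ref p))
    have h4 : (0 : ℚ) < n e := by linarith
    exact_mod_cast h4
  obtain ⟨n', hn⟩ := exists_add_ite_eq (I := I) hpos
  have hsteps : RacOp.SeqStep (.test (S.wrapCheck p Y) ::
      (RacOp.incAll {c | c ∈ S.incoming p ∧ .ref c.1.1 ∈ Y} ++
        RacOp.decAll {c | c ∈ S.outgoing p ∧ .ref c.1.2 ∈ Y})) (n, r₂) (n', r₂) := by
    rw [← hI, ← hO]
    exact ⟨_, .test _ _ _ hY, (RacOp.seqStep_incAll_decAll _ _ _ _).2 ⟨rfl, hn⟩⟩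
  have hsave : RacOp.SeqStep [.guess (.aux p), .test (.eq (.aux p) (.ref p))] (n, r) (n, r₁) :=
    ⟨_, .guess _ _ _ (r (.ref p)), _,
      .test _ _ _ ((setAt_same ..).trans (setAt_of_ne _ _ (by simp)).symm), rfl⟩
  have hguess : RacOp.SeqStep [.guess (.ref p)] (n, r₁) (n, r₂) := ⟨_, .guess _ _ _ v, rfl⟩
  exact ⟨_, _, n', r₂, .cons (toRAC_step (.elapseSave ℓ l p t) hsave)
    (.cons (toRAC_step (.elapseGuess ℓ l p t) hguess)
      (.cons (toRAC_step (.elapseWrap ℓ l p t Y hYsub) hsteps)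
        (.single (toRAC_step (.elapseEnd ℓ _ p t) ⟨_, .nop _ _, rfl⟩)))),
    h.delay_fract p hchan hclk href haux hδ hY hI hO hn⟩

theorem path_elapse (hchan : ∀ p, ¬ S.chan p p) (p : S.Proc) (t : S.Loc p)
    (ht : (c.loc p, .elapse, t) ∈ S.rules p) (h : Describes l n r c) {δ : ℚ≥0}
    (hord : (c.delay p δ).Ordered) :
    ∃ w l' n' r',
      (S.toRAC M).sem.Path (TLoc.main c.loc l, n, r) w (TLoc.main (setAt c.loc p t) l', n', r') ∧
      Describes l' n' r' (c.delay p δ) := by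
  have hle : (⌊δ⌋₊ : ℚ≥0) ≤ δ := Nat.floor_le zero_le
  have hadd : (⌊δ⌋₊ : ℚ≥0) + (δ - ⌊δ⌋₊) = δ := add_tsub_cancel_of_le hle
  have hlt : δ - ⌊δ⌋₊ < 1 := by
    rw [tsub_lt_iff_left hle]
    exact Nat.lt_floor_add_one δ
  rw [← hadd, ← RvConfig.delay_delay] at hord ⊢
  -- An intermediate delay is admissible: a longer delay of `p` only relaxes the incoming channels,
  -- and the outgoing ones are bounded by the ordered final configuration.
  have hord' : (c.delay p (⌊δ⌋₊ : ℚ≥0)).Ordered := by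
    intro s q hsq
    have h1 := h.ordered s q hsq
    have h2 := hord s q hsq
    have hne := ne_of_chan hchan hsq
    by_cases hs : s = p
    · subst hs
      simp only [RvConfig.delay, setAt_same, setAt_setAt, setAt_of_ne _ _ hne.symm] at h2 ⊢
      exact le_self_add.trans h2
    · by_cases hq : q = p
      · subst hq
        simp only [RvConfig.delay, setAt_same, setAt_of_ne _ _ hne]
        exact h1.trans le_self_add
      · simpa only [RvConfig.delay, setAt_of_ne _ _ hs, setAt_of_ne _ _ hq] using h1
  obtain ⟨w₁, l₁, n₁, hw₁, h₁⟩ := path_elapse_units hchan c.loc p t _ h hord'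
  obtain ⟨w₂, l₂, n₂, r₂, hw₂, h₂⟩ := path_elapse_wrap hchan c.loc p t h₁ hlt hord
  exact ⟨_, l₂, n₂, r₂, .cons (toRAC_step (.elapseStart _ _ _ _ ht) ⟨_, .nop _ _, rfl⟩)
    (hw₁.append hw₂), h₂⟩

theorem path_of_rvStep (hchan : ∀ p, ¬ S.chan p p) (hsimple : S.IsSimple) (hlocal : S.NoLocalDiff)
    (hM : S.BoundedBy M) {d : S.RvConfig} {a : S.RvAction} (hs : S.RvStep c a d)
    (hd : d.Ordered) (h : Describes l n r c) :
    ∃ w l' n' r',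
      (S.toRAC M).sem.Path (TLoc.main c.loc l, n, r) w (TLoc.main d.loc l', n', r') ∧
      Describes l' n' r' d := by
  cases hs with
  | nop p t ht =>
    exact ⟨_, l, n, r, .single (toRAC_step (.nop _ _ _ _ ht) ⟨_, .nop _ _, rfl⟩), h.with_loc _⟩
  | test p t φ ht hφ =>
    obtain ⟨b, rfl, hb⟩ := hlocal _ _ _ _ ht
    have hbd := hM.test _ _ _ _ ht
    cases b with
    | ineq x hx s k =>
      exact ⟨_, l, n, r, .single (toRAC_step (.testIneq _ _ _ _ _ hx _ _ ht
        ((h.sat_ineq hx s (hsimple.clk _ _) hbd).2 hφ)) ⟨_, .nop _ _, rfl⟩), h.with_loc _⟩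
    | modular x hx m hm k =>
      exact ⟨_, l, n, r, .single (toRAC_step (.testMod _ _ _ _ _ hx _ hm _ ht
        ((h.sat_modular hx hm k (hsimple.clk _ _) hbd).2 hφ)) ⟨_, .nop _ _, rfl⟩), h.with_loc _⟩
    | zero x hx s =>
      exact ⟨_, l, n, r, .single (toRAC_step (.testZero _ _ _ _ _ hx _ ht)
        ⟨_, .test _ _ _ ((h.sat_zero hx s).1 hφ), rfl⟩), h.with_loc _⟩
    | order x y hx hy s =>
      exact ⟨_, l, n, r, .single (toRAC_step (.testOrder _ _ _ _ _ _ hx hy _ ht)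
        ⟨_, .test _ _ _ ((h.sat_order hx hy s).1 hφ), rfl⟩), h.with_loc _⟩
    | ineqDiff => exact hb.elim
    | modularDiff => exact hb.elim
  | reset p t x ht =>
    refine ⟨_, _, n, _, .single (toRAC_step (.reset _ _ _ _ x ht)
      ⟨_, .guess _ _ _ (r (.ref p)), _, .test _ _ _ ?_, rfl⟩), h.reset p x _⟩
    exact (setAt_same ..).trans (setAt_of_ne _ _ (by simp)).symm
  | elapse p t δ ht =>
    obtain ⟨w, l', n', r', hw, h'⟩ := path_elapse hchan p t ht h (δ := δ) hd
    exact ⟨w, l', n', r', hw, h'.with_loc _⟩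
  | pair p q hpq m ψ ψ' t t' κ δ ht ht' hdom hδ hψ hψ' =>
    obtain ⟨x, rfl⟩ := hsimple.send _ _ _ _ _ _ _ ht
    -- Only the clock named by the send constraint matters, since the matching receive constraint
    -- reads the same one.
    have hκ : κ x = 0 := (Constraint.sat_isZero_iff
      (kind := Sum.elim (S.kind p) (S.chKind p q)) (x := .inr x)
      (μ := Sum.elim (fun x => c.val ⟨p, x⟩) κ) (hsimple.chClk _ _ _) (hdom x)).1 hψ
    cases hsimple.sameClk _ _ _ _ _ _ _ _ _ _ ht ht' with
    | ineq hx s k =>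
      exact ⟨_, l, n, r, .single (toRAC_step (.pairIneq _ _ _ _ hpq _ _ _ x hx s k ht ht')
        ⟨_, .testIneq _ _ _ _ _
          ((h.sat_receive_ineq hpq hδ hκ hx (hsimple.chClk _ _ _) s k _).1 hψ'), rfl⟩), h.with_loc _⟩
    | modular hx d hd k =>
      exact ⟨_, l, n, r, .single (toRAC_step (.pairMod _ _ _ _ hpq _ _ _ x hx d hd k ht ht')
        ⟨_, .testMod _ _ _ _ _ _
          ((h.sat_receive_modular hpq hδ hκ hx (hsimple.chClk _ _ _) d hd k _).1 hψ'), rfl⟩),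
        h.with_loc _⟩
    | order y hx hy s =>
      exact ⟨_, l, n, r, .single (toRAC_step (.pairOrder _ _ _ _ hpq _ _ _ x y hx hy s ht ht')
        ⟨_, .test _ _ _ ((h.sat_receive_order hpq hδ hκ y hx hy s).1 hψ'), rfl⟩), h.with_loc _⟩

/-- Zero clocks and equal reference times make the class and the counters zero and align the
registers, possibly at different points of the circle in unconnected parts of the system. One use of
the rotation rule then sends all of them to 0. -/
theorem path_of_final (h : Describes l n r c) (hloc : c.loc = S.final) (hval : ∀ x, c.val x = 0)
    (hnow : ∀ p q, S.chan p q → c.now p = c.now q) :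
    ∃ w, (S.toRAC M).sem.Path (TLoc.main c.loc l, n, r) w
      (TLoc.main S.final (S.zeroUnary M), fun _ => 0, fun _ => UnitIco.zero) := by
  obtain rfl : l = S.zeroUnary M := by
    funext x
    rw [← h.of_val, hval]
    rfl
  have hdes : ∀ e : S.Chan, n e = 0 ∧ r (.ref e.1.2) = r (.ref e.1.1) := by
    intro e
    have h1 := h.chan e
    rw [hnow _ _ e.2] at h1
    have h2 := Int.fract_nonneg ((r (.ref e.1.2) : ℚ) - r (.ref e.1.1))
    have h3 : (0 : ℚ) ≤ n e := Nat.cast_nonneg _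
    refine ⟨?_, (RegFormula.fract_sub_eq_zero_iff _ _).1 (by linarith)⟩
    have h4 : (n e : ℚ) = 0 := by linarith
    exact_mod_cast h4
  obtain rfl : n = fun _ => 0 := funext fun e => (hdes e).1
  rw [hloc]
  refine ⟨_, .single (toRAC_step .rotate ⟨_, .test _ _ _ (sat_aligned.2 ⟨fun x => ?_, fun e =>
    (hdes e).2.symm⟩), (RacOp.seqStep_append _ _ _ _).2 ⟨_, (RacOp.seqStep_guessAll _
    (_, fun _ => UnitIco.zero)).2 rfl, _, .test _ _ _ (sat_aligned.2 ⟨fun _ => rfl, fun _ => rfl⟩),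
    rfl⟩⟩)⟩
  have h1 := h.fract_val x
  rw [hval] at h1
  exact ((RegFormula.fract_sub_eq_zero_iff _ _).1 (by simpa using h1.symm)).symm

end Forward

/- ## From the register automaton to the rendezvous semantics -/

/-- A configuration of the register automaton describes one of the rendezvous semantics; during
the simulation of a time elapse transition, the latter is the one before the transition. -/
def Simulated (c : S.RvConfig) : S.TLoc M × (S.Chan → ℕ) × (S.TReg → UnitIco) → Prop
  | (.main ℓ l, n, r) => c.loc = ℓ ∧ Describes l n r c
  | (.tmp i ℓ p t l, n, r) => c.loc = ℓ ∧ (ℓ p, .elapse, t) ∈ S.rules p ∧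
      (i = 1 → r (.aux p) = r (.ref p)) ∧
      ∃ δ, Describes l n (if i = 2 then setAt r (.ref p) (r (.aux p)) else r) (c.delay p δ)

/-- Each rule corresponds to at most one rendezvous step: starting an elapse, its intermediate moves
and the rotation correspond to none. -/
theorem rvStep_of_tRule (hchan : ∀ p, ¬ S.chan p p) (hsimple : S.IsSimple)
    (hM : S.BoundedBy M) {a b : S.TLoc M} {w : List S.TOp}
    {d e : (S.Chan → ℕ) × (S.TReg → UnitIco)} (hab : S.TRule M a w b) (hw : RacOp.SeqStep w d e)
    {c : S.RvConfig} (h : Simulated c (a, d)) :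
    ∃ c', Simulated c' (b, e) ∧ (c' = c ∨ c'.Ordered ∧ ∃ o, S.RvStep c o c') := by
  obtain ⟨n, r⟩ := d
  cases hab with
  | nop ℓ l p t ht =>
    obtain ⟨rfl, h⟩ := h
    obtain rfl : (n, r) = e := by simpa [RacOp.seqStep_singleton, RacOp.step_nop] using hw
    exact ⟨_, ⟨rfl, h.with_loc (setAt c.loc p t)⟩, .inr ⟨h.ordered, _, .nop c p t ht⟩⟩
  | elapseStart ℓ l p t ht =>
    obtain ⟨rfl, h⟩ := h
    obtain rfl : (n, r) = e := by simpa [RacOp.seqStep_singleton, RacOp.step_nop] using hw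
    exact ⟨c, ⟨rfl, ht, by simp, 0, by simpa [RvConfig.delay_zero] using h⟩, .inl rfl⟩
  | elapseUnit ℓ l p t =>
    obtain ⟨rfl, ht, -, δ, h⟩ := h
    obtain ⟨n', r'⟩ := e
    obtain ⟨hr, hn⟩ := (RacOp.seqStep_incAll_decAll _ _ _ _).1 hw
    obtain rfl : r' = r := hr
    refine ⟨c, ⟨rfl, ht, by simp, δ + 1, ?_⟩, .inl rfl⟩
    rw [← RvConfig.delay_delay]
    simp only [Fin.reduceEq, if_false] at h ⊢
    exact h.delay_one p hchan hn
  | elapseSave ℓ l p t =>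
    obtain ⟨rfl, ht, -, δ, h⟩ := h
    simp only [RacOp.seqStep_cons, RacOp.seqStep_nil, RacOp.step_guess, RacOp.step_test] at hw
    obtain ⟨_, ⟨v, rfl⟩, _, ⟨hv, rfl⟩, rfl⟩ := hw
    refine ⟨c, ⟨rfl, ht, fun _ => hv, δ, ?_⟩, .inl rfl⟩
    simp only [Fin.reduceEq, if_false] at h ⊢
    exact h.congr_regs (fun _ => setAt_of_ne _ _ (by simp)) (fun _ => setAt_of_ne _ _ (by simp))
  | elapseGuess ℓ l p t =>
    obtain ⟨rfl, ht, haux, δ, h⟩ := h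
    simp only [RacOp.seqStep_singleton, RacOp.step_guess] at hw
    obtain ⟨v, rfl⟩ := hw
    refine ⟨c, ⟨rfl, ht, by simp, δ, ?_⟩, .inl rfl⟩
    simp only [Fin.reduceEq, if_false, if_true, setAt_setAt] at h ⊢
    -- After the guess the description uses the registers with `ref p` put back to the saved value,
    -- so it is unchanged.
    rw [setAt_of_ne _ _ (by simp), haux rfl, setAt_eq_self]
    exact h
  | elapseWrap ℓ l p t Y hY =>
    obtain ⟨rfl, ht, -, δ, h⟩ := h
    rw [RacOp.seqStep_cons] at hw
    simp only [RacOp.step_test] at hw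
    obtain ⟨_, ⟨hY, rfl⟩, hw⟩ := hw
    obtain ⟨n', r'⟩ := e
    obtain ⟨hr, hn⟩ := (RacOp.seqStep_incAll_decAll _ _ _ _).1 hw
    obtain rfl : r' = r := hr
    simp only [if_true] at h
    -- The guessed register fixes the additional delay modulo 1 only; its representative below 1 is
    -- chosen, whole units having been counted earlier.
    let f : ℚ≥0 := ⟨Int.fract ((r' (.ref p) : ℚ) - r' (.aux p)), Int.fract_nonneg _⟩
    refine ⟨c, ⟨rfl, ht, by simp, δ + f, ?_⟩, .inl rfl⟩
    rw [← RvConfig.delay_delay]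
    simp only [Fin.reduceEq, if_false]
    exact h.delay_fract p hchan (fun _ => (setAt_of_ne _ _ (by simp)).symm)
      (fun q hq => (setAt_of_ne _ _ (by simpa using hq)).symm) (setAt_same r' _ _).symm
      (by rw [setAt_same]; rfl) hY rfl rfl hn
  | elapseEnd ℓ l p t =>
    obtain ⟨rfl, ht, -, δ, h⟩ := h
    obtain rfl : (n, r) = e := by simpa [RacOp.seqStep_singleton, RacOp.step_nop] using hw
    simp only [Fin.reduceEq, if_false] at h
    -- The accumulated δ is spent in a single elapse step.
    exact ⟨_, ⟨rfl, h.with_loc (setAt c.loc p t)⟩, .inr ⟨h.ordered, _, .elapse c p t δ ht⟩⟩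
  | testIneq ℓ l p t x hx s k ht hl =>
    obtain ⟨rfl, h⟩ := h
    obtain rfl : (n, r) = e := by simpa [RacOp.seqStep_singleton, RacOp.step_nop] using hw
    exact ⟨_, ⟨rfl, h.with_loc (setAt c.loc p t)⟩, .inr ⟨h.ordered, _, .test c p t _ ht
      ((h.sat_ineq hx s (hsimple.clk _ _) (hM.test _ _ _ _ ht)).1 hl)⟩⟩
  | testMod ℓ l p t x hx m hm k ht hl =>
    obtain ⟨rfl, h⟩ := h
    obtain rfl : (n, r) = e := by simpa [RacOp.seqStep_singleton, RacOp.step_nop] using hw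
    exact ⟨_, ⟨rfl, h.with_loc (setAt c.loc p t)⟩, .inr ⟨h.ordered, _, .test c p t _ ht
      ((h.sat_modular hx hm k (hsimple.clk _ _) (hM.test _ _ _ _ ht)).1 hl)⟩⟩
  | testZero ℓ l p t x hx s ht =>
    obtain ⟨rfl, h⟩ := h
    obtain ⟨hr, rfl⟩ := (RacOp.step_test _ _ _).1 ((RacOp.seqStep_singleton _ _ _).1 hw)
    exact ⟨_, ⟨rfl, h.with_loc (setAt c.loc p t)⟩, .inr ⟨h.ordered, _,
      .test c p t _ ht ((h.sat_zero hx s).2 hr)⟩⟩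
  | testOrder ℓ l p t x y hx hy s ht =>
    obtain ⟨rfl, h⟩ := h
    obtain ⟨hr, rfl⟩ := (RacOp.step_test _ _ _).1 ((RacOp.seqStep_singleton _ _ _).1 hw)
    exact ⟨_, ⟨rfl, h.with_loc (setAt c.loc p t)⟩, .inr ⟨h.ordered, _,
      .test c p t _ ht ((h.sat_order hx hy s).2 hr)⟩⟩
  | reset ℓ l p t x ht =>
    obtain ⟨rfl, h⟩ := h
    simp only [RacOp.seqStep_cons, RacOp.seqStep_nil, RacOp.step_guess, RacOp.step_test] at hw
    obtain ⟨_, ⟨v, rfl⟩, _, ⟨hv, rfl⟩, rfl⟩ := hw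
    have hv : v = r (.ref p) := by
      simpa [RegFormula.Sat, setAt_of_ne] using hv
    subst hv
    exact ⟨_, ⟨rfl, h.reset p x _⟩, .inr ⟨h.ordered, _, .reset c p t x ht⟩⟩
  | pairIneq ℓ l p q hpq t t' m x hx s k ht ht' =>
    obtain ⟨rfl, h⟩ := h
    obtain ⟨hr, rfl⟩ := (RacOp.step_testIneq _ _ _ _ _).1 ((RacOp.seqStep_singleton _ _ _).1 hw)
    -- The desynchronisation is a truncated difference, exact because the configuration is ordered;
    -- the channel clocks are all taken to start at 0.
    have hδ := (add_tsub_cancel_of_le (h.ordered p q hpq)).symm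
    exact ⟨_, ⟨rfl, h.with_loc (setAt (setAt c.loc p t) q t')⟩, .inr ⟨h.ordered, _,
      .pair c p q hpq m _ _ t t' (fun _ => 0) _ ht ht' (fun _ => ClockKind.domain_zero _) hδ
      ((Constraint.sat_isZero_iff (kind := Sum.elim (S.kind p) (S.chKind p q)) (x := .inr x)
        (hsimple.chClk _ _ _) (ClockKind.domain_zero _)).2 rfl)
      ((h.sat_receive_ineq hpq hδ rfl hx (hsimple.chClk _ _ _) s k _).2 hr)⟩⟩
  | pairMod ℓ l p q hpq t t' m x hx d hd k ht ht' =>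
    obtain ⟨rfl, h⟩ := h
    obtain ⟨hr, rfl⟩ := (RacOp.step_testMod _ _ _ _ _ _).1 ((RacOp.seqStep_singleton _ _ _).1 hw)
    have hδ := (add_tsub_cancel_of_le (h.ordered p q hpq)).symm
    exact ⟨_, ⟨rfl, h.with_loc (setAt (setAt c.loc p t) q t')⟩, .inr ⟨h.ordered, _,
      .pair c p q hpq m _ _ t t' (fun _ => 0) _ ht ht' (fun _ => ClockKind.domain_zero _) hδ
      ((Constraint.sat_isZero_iff (kind := Sum.elim (S.kind p) (S.chKind p q)) (x := .inr x)
        (hsimple.chClk _ _ _) (ClockKind.domain_zero _)).2 rfl)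
      ((h.sat_receive_modular hpq hδ rfl hx (hsimple.chClk _ _ _) d hd k _).2 hr)⟩⟩
  | pairOrder ℓ l p q hpq t t' m x y hx hy s ht ht' =>
    obtain ⟨rfl, h⟩ := h
    obtain ⟨hr, rfl⟩ := (RacOp.step_test _ _ _).1 ((RacOp.seqStep_singleton _ _ _).1 hw)
    have hδ := (add_tsub_cancel_of_le (h.ordered p q hpq)).symm
    exact ⟨_, ⟨rfl, h.with_loc (setAt (setAt c.loc p t) q t')⟩, .inr ⟨h.ordered, _,
      .pair c p q hpq m _ _ t t' (fun _ => 0) _ ht ht' (fun _ => ClockKind.domain_zero _) hδ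
      ((Constraint.sat_isZero_iff (kind := Sum.elim (S.kind p) (S.chKind p q)) (x := .inr x)
        (hsimple.chClk _ _ _) (ClockKind.domain_zero _)).2 rfl)
      ((h.sat_receive_order hpq hδ rfl y hx hy s).2 hr)⟩⟩
  | rotate =>
    obtain ⟨hloc, h⟩ := h
    obtain ⟨n', r'⟩ := e
    simp only [RacOp.seqStep_cons, RacOp.seqStep_append, RacOp.seqStep_nil, RacOp.step_test] at hw
    obtain ⟨_, ⟨hr, rfl⟩, ⟨n'', r''⟩, hg, _, ⟨hr', rfl⟩, hf⟩ := hw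
    obtain ⟨rfl, rfl⟩ := Prod.mk.inj hf
    obtain rfl : n'' = n := (RacOp.seqStep_guessAll _ _).1 hg
    exact ⟨c, ⟨hloc, h.rotate hr hr'⟩, .inl rfl⟩

theorem final_of_describes {r : S.TReg → UnitIco} (hr : ∀ a, r a = UnitIco.zero) {c : S.RvConfig}
    (h : Describes (S.zeroUnary M) (fun _ => 0) r c) :
    (∀ x, c.val x = 0) ∧ ∀ p q, S.chan p q → c.now p = c.now q := by
  constructor
  · intro x
    obtain ⟨m, hm, hv⟩ := h.clk x
    have hm0 : UnaryClass.ofNat M m = UnaryClass.ofNat M 0 := by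
      rw [← hm, zeroUnary, UnaryClass.of_eq_ofNat, Nat.floor_zero]
    rw [UnaryClass.ofNat_eq_zero_iff] at hm0
    simpa [hm0, hr] using hv
  · intro p q hpq
    have := h.chan ⟨(p, q), hpq⟩
    simpa [hr, eq_comm] using this

end TCA

/-! ### The equivalence. -/

theorem mainTheorem4 (S : TCA.{u}) (M : ℕ) [NeZero M]
    (hchan : ∀ p, ¬ S.chan p p) (hsimple : S.IsSimple) (hlocal : S.NoLocalDiff)
    (hM : S.BoundedBy M) :
    S.rendezvous.NonEmptiness ↔ (S.toRAC M).sem.NonEmptiness := by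
  constructor
  · rintro ⟨w, c, ⟨hloc, hval, hnow⟩, hw⟩
    obtain ⟨w₁, _, hw₁, l, n, r, rfl, h⟩ := hw.simulate (B := (S.toRAC M).sem)
      -- Only main locations are related here, as each rendezvous step is matched by a path that
      -- runs through all temporary ones.
      (fun (c : {c : S.RvConfig // c.Ordered}) t =>
        ∃ (l : S.Unary M) (n : S.Chan → ℕ) (r : S.TReg → UnitIco),
        t = (TCA.TLoc.main c.1.loc l, n, r) ∧ TCA.Describes l n r c.1)
      (by
        rintro c _ a d ⟨l, n, r, rfl, h⟩ hs
        obtain ⟨w, l', n', r', hw, h'⟩ :=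
          TCA.path_of_rvStep hchan hsimple hlocal hM hs d.2 h
        exact ⟨w, _, hw, l', n', r', rfl, h'⟩)
      (t := (S.toRAC M).sem.start)
      ⟨_, _, _, rfl, TCA.start_describes _ (fun _ => rfl) _⟩
    obtain ⟨w₂, hw₂⟩ := TCA.path_of_final h hloc hval hnow
    exact ⟨_, _, rfl, hw₁.append hw₂⟩
  · rintro ⟨w, _, rfl, hw⟩
    have hstart : TCA.Simulated (M := M) S.rendezvous.start.1 (S.toRAC M).sem.start :=
      ⟨rfl, TCA.start_describes _ (fun _ => rfl) _⟩
    obtain ⟨w', c, hw', h⟩ := hw.simulate (B := S.rendezvous)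
      (fun t (c : {c : S.RvConfig // c.Ordered}) => TCA.Simulated (M := M) c.1 t)
      (by
        rintro ⟨a, d⟩ c w ⟨b, e⟩ h ⟨hab, hs⟩
        obtain ⟨c', h', rfl | ⟨ho, o, hst⟩⟩ := TCA.rvStep_of_tRule hchan hsimple hM hab hs h
        · exact ⟨[], c, .nil c, h'⟩
        · exact ⟨[o], ⟨c', ho⟩, .single hst, h'⟩)
      hstart
    exact ⟨w', c, ⟨h.1, TCA.final_of_describes (fun _ => rfl) h.2⟩, hw'⟩
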